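/- **Conventions.** "Space" means $\Delta$-generated space. The $\Delta$-kelleyfication of a topological space is the same set with the final topology with respect to all continuous maps $\mathbb{R}^m\to X$, $m\ge 0$. A *flow* $X$ is a small semicategory enriched over $\Delta$-generated spaces: a set $X^0$ of states, a $\Delta$-generated space $\mathbb{P}X$ of execution paths with continuous source and target maps to the discrete set $X^0$, and a continuous associative composition $x*y$ defined when the target of $x$ is the source of $y$; $\mathbb{P}_{\alpha,\beta}X$ is the subspace of execution paths from $\alpha$ to $\beta$. Let $\square$ be the subcategory of sets with objects $[n]=\{0,1\}^n$ ($n\ge 0$) generated by the maps $\delta_i^{\epsilon}:[n-1]\to[n]$ inserting $\epsilon\in\{0,1\}$ at position $i$. A *precubical set* is a presheaf $K$ on $\square$, with $K_n=K([n])$, and $|K|_{geom}=\varinjlim_{\square[n]\to K}[0,1]^n$ is its geometric realization. **Natural paths.** For $n\ge 1$, a tame natural $d$-path of $[0,1]^n$ is a continuous map $\gamma=(\gamma_1,\dots,\gamma_n):[0,n]\to[0,1]^n$, nondecreasing in each coordinate, with $\gamma_1(t)+\dots+\gamma_n(t)=t$ for all $t$; let $N_n$ be the set of these paths, with the compact-open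 topology. A nonconstant tame natural $d$-path of $|K|_{geom}$ is a Moore composition $[c_1;\gamma_1]*\dots*[c_p;\gamma_p]$ with $p\ge 1$, where $c_i$ is a cube of $K$ of dimension $n_i\ge 1$, $\gamma_i\in N_{n_i}$ and $[c_i;\gamma_i]=|c_i|_{geom}\circ\gamma_i$. **Realizations.** The natural $n$-cube $|\square[n]|_{nat}$ is the flow with set of states $\{0,1\}^n$ such that $\mathbb{P}_{\alpha,\beta}|\square[n]|_{nat}$ is, for $\alpha<\beta$, the space $N_m$ of tame natural $d$-paths of the $m$-dimensional subcube from $\alpha$ to $\beta$, and is empty otherwise; composition is the Moore composition. The *natural realization* of $K$ is the colimit of flows $|K|_{nat}=\varinjlim_{\square[n]\to K}|\square[n]|_{nat}$. The *tame concrete realization* $|K|_{tc}$ is the flow with set of states $K_0$ such that $\mathbb{P}_{\alpha,\beta}|K|_{tc}$ is the set of nonconstant tame natural $d$-paths from $\alpha$ to $\beta$ in $|K|_{geom}$, equipped with the $\Delta$-kelleyfication of the relative topology induced by the compact-open topology on $\coprod_{\ell\ge 1}C([0,\ell],|K|_{geom})$; composition is the Moore composition. The maps $\gamma\mapsto |c|_{geom}\circ\gamma$,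 for $c$ a cube of $K$, induce the natural map of flows $|K|_{nat}\to|K|_{tc}$. The precubical set $K$ is *spatial* if for all $(\alpha,\beta)\in K_0\times K_0$ the induced map $\mathbb{P}_{\alpha,\beta}|K|_{nat}\to\mathbb{P}_{\alpha,\beta}|K|_{tc}$ is bijective. **Theorem.** Let $K$ be a spatial precubical set. The natural map of flows $|K|_{nat}\to|K|_{tc}$ is an isomorphism. In particular, for all $(\alpha,\beta)\in K_0\times K_0$, the continuous bijection $\mathbb{P}_{\alpha,\beta}|K|_{nat}\to\mathbb{P}_{\alpha,\beta}|K|_{tc}$ is a homeomorphism, so that $\mathbb{P}_{\alpha,\beta}|K|_{nat}$ is homeomorphic to the space of nonconstant tame natural $d$-paths from $\alpha$ to $\beta$ in $|K|_{geom}$ with the $\Delta$-kelleyfied compact-open topology. -/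

import Mathlib

open CategoryTheory CategoryTheory.Limits Topology Opposite
open scoped unitInterval

universe v u

noncomputable section

namespace Precubical

/-- The `Δ`-kelleyfication of a space: the same set, with the final topology with respect to all
continuous maps from the spaces `ℝⁿ`. -/
abbrev DeltaKelley (Y : Type u) [TopologicalSpace Y] : Type u :=
  WithGeneratedByTopology (fun n : ℕ => Fin n → ℝ) Y

/-- A flow: a small semicategory enriched over `Δ`-generated spaces, presented by its set of states,
its `Δ`-generated space of execution paths, its source and target maps (continuous to the discrete
set of states) and its associative composition `x * y`, defined when the target of `x` is the source
of `y` and continuous on the fibre product taken in `Δ`-generated spaces. -/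
structure Flow where
  State : Type u
  Path : Type u
  [topPath : TopologicalSpace Path]
  [deltaPath : DeltaGeneratedSpace Path]
  src : Path → State
  tgt : Path → State
  isLocallyConstant_src : IsLocallyConstant src
  isLocallyConstant_tgt : IsLocallyConstant tgt
  comp : (x y : Path) → tgt x = src y → Path
  src_comp : ∀ x y h, src (comp x y h) = src x
  tgt_comp : ∀ x y h, tgt (comp x y h) = tgt y
  assoc : ∀ x y z (h : tgt x = src y) (h' : tgt y = src z),
    comp (comp x y h) z ((tgt_comp x y h).trans h') =
      comp x (comp y z h') (h.trans (src_comp y z h').symm)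
  continuous_comp :
    Continuous fun p : DeltaKelley {p : Path × Path // tgt p.1 = src p.2} =>
      comp (WithGeneratedByTopology.equiv p).1.1 (WithGeneratedByTopology.equiv p).1.2
        (WithGeneratedByTopology.equiv p).2

namespace Flow

attribute [instance] Flow.topPath Flow.deltaPath

/-- Maps of flows. -/
@[ext]
structure Hom (X Y : Flow.{u}) where
  onState : X.State → Y.State
  onPath : X.Path → Y.Path
  continuous_onPath : Continuous onPath
  src_onPath : ∀ x, Y.src (onPath x) = onState (X.src x)
  tgt_onPath : ∀ x, Y.tgt (onPath x) = onState (X.tgt x)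
  onPath_comp : ∀ x y (h : X.tgt x = X.src y),
    onPath (X.comp x y h) = Y.comp (onPath x) (onPath y)
      (by rw [tgt_onPath, src_onPath, h])

instance : Category Flow.{u} where
  Hom := Hom
  id X := ⟨id, id, continuous_id, fun _ => rfl, fun _ => rfl, fun _ _ _ => rfl⟩
  comp f g := ⟨g.onState ∘ f.onState, g.onPath ∘ f.onPath,
    g.continuous_onPath.comp f.continuous_onPath,
    fun x => by simp [g.src_onPath, f.src_onPath],
    fun x => by simp [g.tgt_onPath, f.tgt_onPath],
    fun x y h => by simp [f.onPath_comp, g.onPath_comp]⟩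

@[ext]
theorem hom_ext {X Y : Flow.{u}} {f g : X ⟶ Y} (h₁ : f.onState = g.onState)
    (h₂ : f.onPath = g.onPath) : f = g :=
  Hom.ext h₁ h₂

@[simp] theorem id_onState (X : Flow.{u}) : Hom.onState (𝟙 X) = id := rfl
@[simp] theorem id_onPath (X : Flow.{u}) : Hom.onPath (𝟙 X) = id := rfl
@[simp] theorem comp_onState {X Y Z : Flow.{u}} (f : X ⟶ Y) (g : Y ⟶ Z) :
    (f ≫ g).onState = g.onState ∘ f.onState := rfl
@[simp] theorem comp_onPath {X Y Z : Flow.{u}} (f : X ⟶ Y) (g : Y ⟶ Z) :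
    (f ≫ g).onPath = g.onPath ∘ f.onPath := rfl

/-- The space `P_{α,β} X` of execution paths from `α` to `β`. -/
def PathSpace (X : Flow.{u}) (α β : X.State) : Type u :=
  {x : X.Path // X.src x = α ∧ X.tgt x = β}

instance (X : Flow.{u}) (α β : X.State) : TopologicalSpace (X.PathSpace α β) :=
  inferInstanceAs (TopologicalSpace {x : X.Path // X.src x = α ∧ X.tgt x = β})

/-- The continuity of the composition, tested on maps from the generating spaces. -/
theorem continuous_comp_iff {P S : Type u} [TopologicalSpace P] (s t : P → S)
    (c : (x y : P) → t x = s y → P) :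
    (Continuous fun p : DeltaKelley {p : P × P // t p.1 = s p.2} =>
      c (WithGeneratedByTopology.equiv p).1.1 (WithGeneratedByTopology.equiv p).1.2
        (WithGeneratedByTopology.equiv p).2) ↔
    ∀ (n : ℕ) (a b : (Fin n → ℝ) → P) (h : ∀ z, t (a z) = s (b z)),
      Continuous a → Continuous b → Continuous fun z => c (a z) (b z) (h z) := by
  rw [WithGeneratedByTopology.continuous_from_iff]
  constructor
  · intro H n a b h ha hb
    exact H (i := n) ⟨fun z => ⟨(a z, b z), h z⟩, by fun_prop⟩
  · intro H n f
    exact H n (fun z => (f z).1.1) (fun z => (f z).1.2) (fun z => (f z).2)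
      (by fun_prop) (by fun_prop)

/-! Colimits of flows: states are identified as in sets, execution paths are formal composites modulo
the evident relations, with the finest suitable topology; see `Colim.isColimit`. -/

namespace Colim

variable {J : Type u} [Category.{v} J] (F : J ⥤ Flow.{u})

/-- States of the colimit. -/
def State : Type u :=
  Quot fun a b : (Σ j, (F.obj j).State) => ∃ f : a.1 ⟶ b.1, b.2 = (F.map f).onState a.2

/-- The state of the colimit represented by a state of the diagram. -/
def ι (j : J) (a : (F.obj j).State) : State F := Quot.mk _ ⟨j, a⟩

theorem ι_map {j k : J} (f : j ⟶ k) (a : (F.obj j).State) :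
    ι F k ((F.map f).onState a) = ι F j a :=
  (Quot.sound ⟨f, rfl⟩).symm

/-- Formal composites of execution paths. -/
inductive Pre : State F → State F → Type u
  | of (j : J) (x : (F.obj j).Path) {a b : State F}
      (ha : ι F j ((F.obj j).src x) = a) (hb : ι F j ((F.obj j).tgt x) = b) : Pre a b
  | comp {a b c : State F} (p : Pre a b) (q : Pre b c) : Pre a c

/-- The relations between formal composites. -/
inductive Rel : ∀ {a b : State F}, Pre F a b → Pre F a b → Prop
  | refl {a b} (p : Pre F a b) : Rel p p
  | symm {a b} {p q : Pre F a b} : Rel p q → Rel q p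
  | trans {a b} {p q r : Pre F a b} : Rel p q → Rel q r → Rel p r
  | congr {a b c} {p p' : Pre F a b} {q q' : Pre F b c} :
      Rel p p' → Rel q q' → Rel (.comp p q) (.comp p' q')
  | assoc {a b c d} (p : Pre F a b) (q : Pre F b c) (r : Pre F c d) :
      Rel (.comp (.comp p q) r) (.comp p (.comp q r))
  | map {j k : J} (f : j ⟶ k) (x : (F.obj j).Path) {a b : State F} (ha hb ha' hb') :
      Rel (.of (a := a) (b := b) k ((F.map f).onPath x) ha hb) (.of j x ha' hb')
  | of_comp {j : J} (x y : (F.obj j).Path) (h : (F.obj j).tgt x = (F.obj j).src y)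
      {a b c : State F} (ha hb ha' hb' ha'' hb'') :
      Rel (.of (a := a) (b := c) j ((F.obj j).comp x y h) ha'' hb'')
        (.comp (.of (a := a) (b := b) j x ha hb) (.of j y ha' hb'))

instance setoid (a b : State F) : Setoid (Pre F a b) where
  r := Rel F
  iseqv := ⟨.refl, .symm, .trans⟩

/-- Execution paths of the colimit. -/
def Path : Type u := Σ ab : State F × State F, Quotient (setoid F ab.1 ab.2)

/-- The execution path of the colimit represented by an execution path of the diagram. -/
def mk (j : J) (x : (F.obj j).Path) : Path F :=
  ⟨(ι F j ((F.obj j).src x), ι F j ((F.obj j).tgt x)), ⟦.of j x rfl rfl⟧⟩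

/-- Composition with fixed endpoints. -/
def compHom {a b c : State F} (p : Quotient (setoid F a b)) (q : Quotient (setoid F b c)) :
    Quotient (setoid F a c) :=
  Quotient.map₂ Pre.comp (fun _ _ h _ _ h' => Rel.congr h h') p q

/-- Composition. -/
def comp (x y : Path F) (h : x.1.2 = y.1.1) : Path F :=
  ⟨(x.1.1, y.1.2), compHom F x.2 (cast (by rw [h]) y.2)⟩

theorem assoc (x y z : Path F) (h : x.1.2 = y.1.1) (h' : y.1.2 = z.1.1) :
    comp F (comp F x y h) z h' = comp F x (comp F y z h') h := by
  obtain ⟨⟨a, b⟩, p⟩ := x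
  obtain ⟨⟨b', c⟩, q⟩ := y
  obtain ⟨⟨c', d⟩, r⟩ := z
  dsimp at h h' p q r
  subst h h'
  induction p using Quotient.ind
  induction q using Quotient.ind
  induction r using Quotient.ind
  exact congrArg (Sigma.mk _) (Quotient.sound (Rel.assoc _ _ _))

theorem mk_eq (j : J) (x : (F.obj j).Path) {a b : State F}
    (ha : ι F j ((F.obj j).src x) = a) (hb : ι F j ((F.obj j).tgt x) = b) :
    mk F j x = ⟨(a, b), ⟦.of j x ha hb⟧⟩ := by
  subst ha hb
  rfl

theorem mk_map {j k : J} (f : j ⟶ k) (x : (F.obj j).Path) :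
    mk F k ((F.map f).onPath x) = mk F j x := by
  rw [mk_eq F k _ (by rw [Hom.src_onPath, ι_map]) (by rw [Hom.tgt_onPath, ι_map])]
  exact congrArg (Sigma.mk _) (Quotient.sound (Rel.map f x _ _ _ _))

theorem comp_congr {x x' y y' : Path F} (hx : x = x') (hy : y = y') (h : x.1.2 = y.1.1) :
    comp F x y h = comp F x' y' (by rw [← hx, ← hy, h]) := by
  subst hx hy
  rfl

theorem mk_comp (j : J) (x y : (F.obj j).Path) (h : (F.obj j).tgt x = (F.obj j).src y) :
    mk F j ((F.obj j).comp x y h) = comp F (mk F j x) (mk F j y) (congrArg (ι F j) h) := by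
  refine (mk_eq F j _ (congrArg (ι F j) ((F.obj j).src_comp x y h))
    (congrArg (ι F j) ((F.obj j).tgt_comp x y h))).trans (Eq.trans ?_
    (comp_congr F rfl (mk_eq F j y (congrArg (ι F j) h.symm) rfl).symm rfl))
  exact congrArg (Sigma.mk _) (Quotient.sound (Rel.of_comp x y h _ _ _ _ _ _))

/-- The topologies on the set of composites for which composition and endpoints are continuous and
which receive all the spaces of the diagram continuously. -/
structure Admissible (t : TopologicalSpace (Path F)) : Prop where
  continuous_mk : ∀ j, Continuous[inferInstance, t] (mk F j)
  src : @IsLocallyConstant _ _ t fun x : Path F => x.1.1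
  tgt : @IsLocallyConstant _ _ t fun x : Path F => x.1.2
  comp : ∀ (n : ℕ) (a b : (Fin n → ℝ) → Path F) (h : ∀ z, (a z).1.2 = (b z).1.1),
    Continuous[inferInstance, t] a → Continuous[inferInstance, t] b →
    Continuous[inferInstance, t] fun z => comp F (a z) (b z) (h z)

/-- The topology induced by a map to a flow, made finer so that endpoints are locally constant. -/
theorem admissible_induced {Y : Type u} [TopologicalSpace Y] (f : Path F → Y)
    (hf : ∀ j, Continuous fun x => f (mk F j x))
    (hc : ∀ (n : ℕ) (a b : (Fin n → ℝ) → Path F) (h : ∀ z, (a z).1.2 = (b z).1.1),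
      Continuous (f ∘ a) → Continuous (f ∘ b) →
      Continuous fun z => f (comp F (a z) (b z) (h z))) :
    Admissible F (TopologicalSpace.induced f inferInstance ⊓
      TopologicalSpace.induced (fun x : Path F => x.1) ⊥) := by
  have lc : ∀ {Z : Type u} [TopologicalSpace Z] (g : Z → State F × State F),
      Continuous[inferInstance, ⊥] g ↔ IsLocallyConstant g := by
    intro Z _ g
    let : TopologicalSpace (State F × State F) := ⊥
    have : DiscreteTopology (State F × State F) := ⟨rfl⟩
    exact (IsLocallyConstant.iff_continuous g).symm
  have lc0 : ∀ {n : ℕ} (g : (Fin n → ℝ) → State F × State F),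
      Continuous[inferInstance, ⊥] g ↔ IsLocallyConstant g := by
    intro n g
    let : TopologicalSpace (State F × State F) := ⊥
    have : DiscreteTopology (State F × State F) := ⟨rfl⟩
    exact (IsLocallyConstant.iff_continuous g).symm
  have lc1 : @IsLocallyConstant _ _ (TopologicalSpace.induced f inferInstance ⊓
      TopologicalSpace.induced (fun x : Path F => x.1) ⊥) (fun x : Path F => x.1) := by
    let : TopologicalSpace (State F × State F) := ⊥
    have : DiscreteTopology (State F × State F) := ⟨rfl⟩
    exact (@IsLocallyConstant.iff_continuous _ _ (_) _ _ _).2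
      (continuous_inf_dom_right continuous_induced_dom)
  refine ⟨fun j => ?_, ?_, ?_, fun n a b h ha hb => ?_⟩
  · rw [continuous_inf_rng, continuous_induced_rng, continuous_induced_rng]
    refine ⟨hf j, (lc _).2 ?_⟩
    exact ((F.obj j).isLocallyConstant_src.comp (ι F j)).prodMk
      ((F.obj j).isLocallyConstant_tgt.comp (ι F j))
  · exact @IsLocallyConstant.comp _ _ _ (_) _ lc1 Prod.fst
  · exact @IsLocallyConstant.comp _ _ _ (_) _ lc1 Prod.snd
  · rw [continuous_inf_rng, continuous_induced_rng, continuous_induced_rng] at *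
    refine ⟨hc n a b h ha.1 hb.1, (lc0 _).2 ?_⟩
    exact (((lc0 _).1 ha.2).comp Prod.fst).prodMk (((lc0 _).1 hb.2).comp Prod.snd)

theorem exists_admissible : ∃ t, Admissible F t :=
  ⟨_, admissible_induced F (fun _ => PUnit.unit) (fun _ => continuous_const)
    fun _ _ _ _ _ _ => continuous_const⟩

/-- The infimum of the admissible topologies. -/
abbrev top : TopologicalSpace (Path F) := sInf {t | Admissible F t}

theorem admissible_top : Admissible F (top F) := by
  obtain ⟨t₀, h₀⟩ := exists_admissible F
  have hle : ∀ t, Admissible F t → top F ≤ t := fun t ht => sInf_le ht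
  refine ⟨fun j => ?_, ?_, ?_, fun n a b h ha hb => ?_⟩
  · exact continuous_sInf_rng.2 fun t ht => ht.continuous_mk j
  · exact fun s => hle t₀ h₀ _ (h₀.src s)
  · exact fun s => hle t₀ h₀ _ (h₀.tgt s)
  · exact continuous_sInf_rng.2 fun t ht => ht.comp n a b h (continuous_le_rng (hle t ht) ha)
      (continuous_le_rng (hle t ht) hb)

/-- The topology of the colimit. -/
abbrev kelleyTop : TopologicalSpace (Path F) :=
  @TopologicalSpace.generatedBy _ (fun n : ℕ => Fin n → ℝ) _ _ (top F)

theorem kelleyTop_le : kelleyTop F ≤ top F := TopologicalSpace.generatedBy_le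

theorem isGeneratedBy_kelleyTop :
    @IsGeneratedBy _ (fun n : ℕ => Fin n → ℝ) _ (Path F) (kelleyTop F) :=
  letI := top F
  inferInstanceAs (IsGeneratedBy (fun n : ℕ => Fin n → ℝ)
    (WithGeneratedByTopology (fun n : ℕ => Fin n → ℝ) (Path F)))

theorem continuous_kelleyTop {Z : Type u} [TopologicalSpace Z] [DeltaGeneratedSpace Z]
    {f : Z → Path F} : Continuous[inferInstance, kelleyTop F] f ↔
      Continuous[inferInstance, top F] f := by
  let := top F
  exact IsGeneratedBy.equiv_symm_comp_continuous_iff (X := fun n : ℕ => Fin n → ℝ) f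

theorem continuous_kelleyTop' {n : ℕ}
    {f : (Fin n → ℝ) → Path F} : Continuous[inferInstance, kelleyTop F] f ↔
      Continuous[inferInstance, top F] f := by
  let := top F
  exact IsGeneratedBy.equiv_symm_comp_continuous_iff (X := fun n : ℕ => Fin n → ℝ) f

/-- The colimit flow. -/
def obj : Flow.{u} :=
  letI := kelleyTop F
  haveI := isGeneratedBy_kelleyTop F
  { State := State F
    Path := Path F
    src := fun x => x.1.1
    tgt := fun x => x.1.2
    isLocallyConstant_src := fun s => kelleyTop_le F _ ((admissible_top F).src s)
    isLocallyConstant_tgt := fun s => kelleyTop_le F _ ((admissible_top F).tgt s)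
    comp := comp F
    src_comp := fun _ _ _ => rfl
    tgt_comp := fun _ _ _ => rfl
    assoc := assoc F
    continuous_comp := (continuous_comp_iff (fun x : Path F => x.1.1) (fun x => x.1.2) (comp F)).2 fun n a b h ha hb =>
      (continuous_kelleyTop' F).2 ((admissible_top F).comp n a b h
        ((continuous_kelleyTop' F).1 ha) ((continuous_kelleyTop' F).1 hb)) }

/-- The colimit cocone. -/
def cocone : Cocone F where
  pt := obj F
  ι :=
    { app := fun j =>
        { onState := ι F j
          onPath := mk F j
          continuous_onPath := (continuous_kelleyTop F).2 ((admissible_top F).continuous_mk j)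
          src_onPath := fun _ => rfl
          tgt_onPath := fun _ => rfl
          onPath_comp := mk_comp F j }
      naturality := fun _ _ f => Flow.hom_ext (funext fun a => ι_map F f a)
        (funext fun x => mk_map F f x) }

variable {F} (c : Cocone F)

/-- The universal map on states. -/
def descState : State F → c.pt.State :=
  Quot.lift (fun a => (c.ι.app a.1).onState a.2) (by
    rintro ⟨j, a⟩ ⟨k, b⟩ ⟨f, hf⟩
    dsimp at f hf ⊢
    rw [hf, ← c.w f]
    rfl)

/-- Evaluation of formal composites in a cocone. -/
def eval : ∀ {a b : State F}, Pre F a b →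
    {y : c.pt.Path // c.pt.src y = descState c a ∧ c.pt.tgt y = descState c b}
  | _, _, .of j x ha hb => ⟨(c.ι.app j).onPath x, by rw [Hom.src_onPath, ← ha]; rfl,
      by rw [Hom.tgt_onPath, ← hb]; rfl⟩
  | _, _, .comp p q => ⟨c.pt.comp (eval p).1 (eval q).1 ((eval p).2.2.trans (eval q).2.1.symm),
      by rw [src_comp, (eval p).2.1], by rw [tgt_comp, (eval q).2.2]⟩

theorem eval_rel {a b : State F} {p q : Pre F a b} (h : Rel F p q) : eval c p = eval c q := by
  induction h with
  | refl => rfl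
  | symm _ ih => exact ih.symm
  | trans _ _ ih ih' => exact ih.trans ih'
  | congr _ _ ih ih' => simp only [eval, ih, ih']
  | assoc p q r => exact Subtype.ext (c.pt.assoc _ _ _ _ _)
  | map f x =>
    refine Subtype.ext ?_
    simp only [eval]
    rw [← c.w f]
    rfl
  | of_comp x y h => exact Subtype.ext (Hom.onPath_comp _ _ _ h)

/-- The universal map on execution paths. -/
def descPath (x : Path F) : c.pt.Path :=
  (Quotient.lift (eval c) (fun _ _ h => eval_rel c h) x.2).1

theorem descPath_comp (x y : Path F) (h : x.1.2 = y.1.1) (h') :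
    descPath c (comp F x y h) = c.pt.comp (descPath c x) (descPath c y) h' := by
  obtain ⟨⟨a, b⟩, p⟩ := x
  obtain ⟨⟨b', d⟩, q⟩ := y
  dsimp at h p q
  subst h
  induction p using Quotient.ind
  induction q using Quotient.ind
  rfl

theorem src_descPath (x : Path F) : c.pt.src (descPath c x) = descState c x.1.1 :=
  (Quotient.lift (eval c) (fun _ _ h => eval_rel c h) x.2).2.1

theorem tgt_descPath (x : Path F) : c.pt.tgt (descPath c x) = descState c x.1.2 :=
  (Quotient.lift (eval c) (fun _ _ h => eval_rel c h) x.2).2.2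

theorem continuous_descPath : Continuous[kelleyTop F, inferInstance] (descPath c) := by
  have h := admissible_induced F (descPath c)
    (fun j => (c.ι.app j).continuous_onPath) (fun n a b h ha hb => by
      have := (continuous_comp_iff _ _ _).1 c.pt.continuous_comp n _ _
        (fun z => by
          rw [Function.comp, Function.comp, tgt_descPath, src_descPath, h z]) ha hb
      have e : (fun z => descPath c (comp F (a z) (b z) (h z))) = _ :=
        funext fun z => descPath_comp c (a z) (b z) (h z)
          (by rw [tgt_descPath, src_descPath, h z])
      rw [e]
      exact this)
  exact continuous_iff_le_induced.2
    ((kelleyTop_le F).trans ((sInf_le h).trans inf_le_left))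

/-- The universal map. -/
def desc : obj F ⟶ c.pt where
  onState := descState c
  onPath := descPath c
  continuous_onPath := continuous_descPath c
  src_onPath := src_descPath c
  tgt_onPath := tgt_descPath c
  onPath_comp := fun x y h => descPath_comp c x y h _

/-- The universal property. -/
def isColimit : IsColimit (cocone F) where
  desc := desc
  fac := fun _ _ => rfl
  uniq := fun c m hm => by
    have hS : ∀ j a, m.onState (ι F j a) = (c.ι.app j).onState a := fun j a =>
      congrFun (congrArg Hom.onState (hm j)) a
    have hP : ∀ j x, m.onPath (mk F j x) = (c.ι.app j).onPath x := fun j a =>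
      congrFun (congrArg Hom.onPath (hm j)) a
    refine Flow.hom_ext (funext ?_) (funext ?_)
    · intro a
      change State F at a
      obtain ⟨j, a⟩ := a
      exact hS j a
    · intro x
      change Path F at x
      obtain ⟨⟨a, b⟩, p⟩ := x
      dsimp at p
      induction p using Quotient.ind with | _ p
      induction p with
      | of j x ha hb => rw [← mk_eq]; exact hP j x
      | comp p q ihp ihq =>
        refine (m.onPath_comp (⟨(_, _), Quotient.mk _ p⟩ : Path F)
          (⟨(_, _), Quotient.mk _ q⟩ : Path F) rfl).trans ?_
        have key : ∀ {x y x' y' : c.pt.Path} (_ : x = x') (_ : y = y')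
            (h : c.pt.tgt x = c.pt.src y) (h' : c.pt.tgt x' = c.pt.src y'),
            c.pt.comp x y h = c.pt.comp x' y' h' := by
          rintro x y _ _ rfl rfl _ _
          rfl
        exact key ihp ihq _ _

end Colim

instance : HasColimitsOfSize.{v, u} Flow.{u} :=
  ⟨fun _ _ => ⟨fun F => ⟨⟨_, Colim.isColimit (F := F)⟩⟩⟩⟩

end Flow

/-- Moore paths `[0, ℓ] → U` whose length `ℓ` is a natural number; the topology is that of the
disjoint union of the spaces `C([0, ℓ], U)` with the compact-open topology. -/
abbrev MoorePath (U : Type u) [TopologicalSpace U] : Type u :=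
  Σ ℓ : ℕ, C(Set.Icc (0 : ℝ) ℓ, U)

namespace MoorePath

variable {U V : Type u} [TopologicalSpace U] [TopologicalSpace V]

/-- The length of a Moore path. -/
def length (p : MoorePath U) : ℕ := p.1

/-- The map underlying `p`, extended to the real line by constants. -/
def ext (p : MoorePath U) : ℝ → U :=
  Set.IccExtend (Nat.cast_nonneg p.1) p.2

/-- The initial point. -/
def source (p : MoorePath U) : U := p.2 ⟨0, le_rfl, Nat.cast_nonneg _⟩

/-- The final point. -/
def target (p : MoorePath U) : U := p.2 ⟨p.1, Nat.cast_nonneg _, le_rfl⟩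

theorem ext_of_mem (p : MoorePath U) {t : ℝ} (ht : t ∈ Set.Icc (0 : ℝ) p.1) :
    p.ext t = p.2 ⟨t, ht⟩ :=
  Set.IccExtend_of_mem _ _ ht

theorem ext_zero (p : MoorePath U) : p.ext 0 = p.source :=
  p.ext_of_mem _

theorem ext_length (p : MoorePath U) : p.ext p.length = p.target :=
  p.ext_of_mem _

theorem continuous_ext (p : MoorePath U) : Continuous p.ext :=
  p.2.continuous.Icc_extend'

theorem eq_of_ext {p q : MoorePath U} (h : p.length = q.length)
    (h' : ∀ t : ℝ, 0 ≤ t → t ≤ p.length → p.ext t = q.ext t) : p = q := by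
  obtain ⟨ℓ, f⟩ := p
  obtain ⟨ℓ', g⟩ := q
  dsimp [length] at h h'
  subst h
  refine congrArg (Sigma.mk ℓ) (ContinuousMap.ext fun t => ?_)
  have := h' t t.2.1 t.2.2
  rwa [ext_of_mem ⟨ℓ, f⟩ t.2, ext_of_mem ⟨ℓ, g⟩ t.2] at this

/-- The path obtained by restricting a function on the line to `[0, ℓ]`. -/
def ofFun (ℓ : ℕ) (f : ℝ → U) (hf : Continuous f) : MoorePath U :=
  ⟨ℓ, ⟨fun t => f t, by fun_prop⟩⟩

theorem ofFun_ext (ℓ : ℕ) (f : ℝ → U) (hf : Continuous f) {t : ℝ} (h0 : 0 ≤ t) (h1 : t ≤ ℓ) :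
    (ofFun ℓ f hf).ext t = f t :=
  ext_of_mem _ ⟨h0, h1⟩

/-- Moore composition. -/
def comp (p q : MoorePath U) (h : p.target = q.source) : MoorePath U :=
  ofFun (p.length + q.length)
    (fun t => if t ≤ p.length then p.ext t else q.ext (t - p.length))
    (Continuous.if_le p.continuous_ext (q.continuous_ext.comp (by fun_prop))
      continuous_id continuous_const (by
        rintro t rfl
        simp only [sub_self, ext_zero, ext_length, h]))

theorem comp_length (p q : MoorePath U) (h) : (p.comp q h).length = p.length + q.length := rfl

theorem comp_ext_left (p q : MoorePath U) (h) {t : ℝ} (h0 : 0 ≤ t) (h1 : t ≤ p.length) :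
    (p.comp q h).ext t = p.ext t := by
  rw [comp, ofFun_ext _ _ _ h0 (h1.trans (by push_cast; linarith [q.length.cast_nonneg (α := ℝ)])),
    if_pos h1]

theorem comp_ext_right (p q : MoorePath U) (h) {t : ℝ} (h0 : p.length ≤ t)
    (h1 : t ≤ p.length + q.length) : (p.comp q h).ext t = q.ext (t - p.length) := by
  rw [comp, ofFun_ext _ _ _ (p.length.cast_nonneg.trans h0) (by push_cast; exact h1)]
  split_ifs with h2
  · obtain rfl : t = p.length := le_antisymm h2 h0
    simp [ext_zero, ext_length, h]
  · rfl

theorem comp_source (p q : MoorePath U) (h) : (p.comp q h).source = p.source := by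
  rw [← ext_zero, comp_ext_left _ _ _ le_rfl (Nat.cast_nonneg _), ext_zero]

theorem comp_target (p q : MoorePath U) (h) : (p.comp q h).target = q.target := by
  rw [← ext_length, comp_ext_right _ _ _ (by simp [comp_length]) (by simp [comp_length]),
    ← ext_length]
  congr 1
  simp [comp_length]

theorem comp_assoc (p q r : MoorePath U) (h : p.target = q.source) (h' : q.target = r.source) :
    (p.comp q h).comp r ((comp_target p q h).trans h') =
      p.comp (q.comp r h') (h.trans (comp_source q r h').symm) := by
  refine eq_of_ext (Nat.add_assoc _ _ _) fun t h0 h1 => ?_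
  simp only [comp_length, Nat.cast_add] at h1
  have hq := q.length.cast_nonneg (α := ℝ)
  rcases le_total t (p.length + q.length) with h2 | h2
  · rw [comp_ext_left _ _ _ h0 (by simpa [comp_length] using h2)]
    rcases le_total t p.length with h3 | h3
    · rw [comp_ext_left _ _ _ h0 h3, comp_ext_left _ _ _ h0 h3]
    · rw [comp_ext_right _ _ _ h3 h2,
        comp_ext_right _ _ _ h3 (by simp only [comp_length, Nat.cast_add]; linarith),
        comp_ext_left _ _ _ (by linarith) (by linarith)]
  · rw [comp_ext_right _ _ _ (by simpa [comp_length] using h2)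
        (by simp only [comp_length, Nat.cast_add]; linarith),
      comp_ext_right _ _ _ (by linarith) (by simp only [comp_length, Nat.cast_add]; linarith),
      comp_ext_right _ _ _ (by linarith) (by linarith)]
    congr 1
    simp only [comp_length, Nat.cast_add]
    ring

/-- Composition with a continuous map. -/
def map (f : C(U, V)) (p : MoorePath U) : MoorePath V := ⟨p.1, f.comp p.2⟩

theorem map_length (f : C(U, V)) (p : MoorePath U) : (p.map f).length = p.length := rfl

theorem map_ext (f : C(U, V)) (p : MoorePath U) (t : ℝ) : (p.map f).ext t = f (p.ext t) := rfl

theorem map_source (f : C(U, V)) (p : MoorePath U) : (p.map f).source = f p.source := rfl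

theorem map_target (f : C(U, V)) (p : MoorePath U) : (p.map f).target = f p.target := rfl

theorem map_map {W : Type u} [TopologicalSpace W] (g : C(V, W)) (f : C(U, V)) (p : MoorePath U) :
    (p.map f).map g = p.map (g.comp f) := rfl

theorem map_congr {f g : C(U, V)} (h : ∀ x, f x = g x) (p : MoorePath U) : p.map f = p.map g := by
  rw [ContinuousMap.ext h]

theorem map_eq_self {f : C(U, U)} (h : ∀ x, f x = x) (p : MoorePath U) : p.map f = p :=
  map_congr (g := ContinuousMap.id U) h p

theorem map_comp (f : C(U, V)) (p q : MoorePath U) (h : p.target = q.source) :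
    (p.comp q h).map f = (p.map f).comp (q.map f)
      (by rw [map_target, map_source, h]) := by
  refine eq_of_ext rfl fun t h0 h1 => ?_
  rw [map_length, comp_length, Nat.cast_add] at h1
  rcases le_total t p.length with h2 | h2
  · rw [map_ext, comp_ext_left _ _ _ h0 h2, comp_ext_left (p.map f) _ _ h0 h2, map_ext]
  · rw [map_ext, comp_ext_right _ _ _ h2 h1, comp_ext_right (p.map f) (q.map f) _ h2 h1, map_ext]
    rfl

theorem continuous_map (f : C(U, V)) : Continuous (map f) :=
  continuous_sigma_iff.2 fun _ =>
    continuous_sigmaMk.comp (ContinuousMap.continuous_postcomp f)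

/-- Continuity of a family of Moore paths. -/
theorem continuous_iff {Z : Type*} [TopologicalSpace Z] (f : Z → MoorePath U) :
    Continuous f ↔ IsLocallyConstant (fun z => (f z).length) ∧
      Continuous fun x : Z × ℝ => (f x.1).ext x.2 := by
  constructor
  · intro hf
    have h1 : IsLocallyConstant (fun z => (f z).length) :=
      (IsLocallyConstant.iff_continuous _).2
        ((continuous_sigma_iff.2 fun _ => continuous_const :
          Continuous (fun p : MoorePath U => p.length)).comp hf)
    refine ⟨h1, ?_⟩
    have : Continuous fun x : MoorePath U × ℝ => x.1.ext x.2 := by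
      have e : ∀ ℓ : ℕ, Continuous fun x : C(Set.Icc (0 : ℝ) ℓ, U) × ℝ =>
          MoorePath.ext ⟨ℓ, x.1⟩ x.2 := fun ℓ => by
        have h0 : (0 : ℝ) ≤ ℓ := Nat.cast_nonneg _
        have : Continuous fun x : C(Set.Icc (0 : ℝ) ℓ, U) × ℝ =>
            x.1 (Set.projIcc 0 (ℓ : ℝ) h0 x.2) := by
          have h2 : Continuous fun x : C(Set.Icc (0 : ℝ) ℓ, U) × ℝ =>
              (Set.projIcc 0 (ℓ : ℝ) h0 x.2) := continuous_projIcc.comp continuous_snd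
          exact continuous_fst.eval h2
        exact this
      rw [continuous_iff_continuousAt]
      rintro ⟨⟨ℓ, g⟩, t⟩
      have hs : IsOpenEmbedding fun g : C(Set.Icc (0 : ℝ) ℓ, U) => (⟨ℓ, g⟩ : MoorePath U) :=
        @IsOpenEmbedding.sigmaMk ℕ (fun ℓ : ℕ => C(Set.Icc (0 : ℝ) ℓ, U)) _ ℓ
      have ho : IsOpenEmbedding fun x : C(Set.Icc (0 : ℝ) ℓ, U) × ℝ =>
          ((⟨ℓ, x.1⟩ : MoorePath U), x.2) :=
        hs.prodMap IsOpenEmbedding.id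
      exact (ho.continuousAt_iff (x := (g, t))).1 (e ℓ).continuousAt
    exact this.comp (hf.prodMap continuous_id)
  · rintro ⟨h1, h2⟩
    rw [continuous_iff_continuousAt]
    intro z
    have ho : IsOpen {w | (f w).length = (f z).length} := h1.isOpen_fiber _
    refine ContinuousOn.continuousAt (s := {w | (f w).length = (f z).length}) ?_
      (ho.mem_nhds rfl)
    rw [continuousOn_iff_continuous_domRestrict]
    have : ({w | (f w).length = (f z).length}.domRestrict f) =
        fun w => (⟨(f z).length, (⟨fun x : {w | (f w).length = (f z).length} ×
          Set.Icc (0 : ℝ) (f z).length => (f x.1.1).ext x.2,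
            h2.comp (by fun_prop : Continuous fun x : {w | (f w).length = (f z).length} ×
          Set.Icc (0 : ℝ) (f z).length => ((x.1.1, (x.2 : ℝ)) : Z × ℝ))⟩ : C(_, U)).curry w⟩ :
            MoorePath U) := by
      funext w
      refine eq_of_ext w.2 fun t ht0 ht1 => ?_
      have ht2 : t ≤ (f z).length := ht1.trans (Nat.cast_le.2 (le_of_eq w.2))
      have key : ∀ g : C(Set.Icc (0 : ℝ) (f z).length, U),
          ext ⟨(f z).length, g⟩ t = g ⟨t, ht0, ht2⟩ := fun g =>
        ext_of_mem ⟨(f z).length, g⟩ ⟨ht0, ht2⟩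
      refine ((key _).trans ?_).symm
      rfl
    rw [this]
    exact continuous_sigmaMk.comp (ContinuousMap.continuous _)

theorem continuous_comp {Z : Type*} [TopologicalSpace Z] {f g : Z → MoorePath U}
    (hf : Continuous f) (hg : Continuous g) (h : ∀ z, (f z).target = (g z).source) :
    Continuous fun z => (f z).comp (g z) (h z) := by
  rw [continuous_iff] at hf hg ⊢
  refine ⟨(hf.1.prodMk hg.1).comp fun x => x.1 + x.2, ?_⟩
  have hc1 : Continuous fun z => ((f z).length : ℝ) := (hf.1.comp Nat.cast).continuous
  have hc2 : Continuous fun z => ((g z).length : ℝ) := (hg.1.comp Nat.cast).continuous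
  have key : (fun x : Z × ℝ => ((f x.1).comp (g x.1) (h x.1)).ext x.2) = fun x =>
      if min (max x.2 0) (((f x.1).length : ℝ) + (g x.1).length) ≤ ((f x.1).length : ℝ) then
        (f x.1).ext (min (max x.2 0) (((f x.1).length : ℝ) + (g x.1).length)) else
        (g x.1).ext (min (max x.2 0) (((f x.1).length : ℝ) + (g x.1).length) - (f x.1).length) := by
    funext x
    have hp : (0 : ℝ) ≤ (f x.1).length + (g x.1).length := by positivity
    have : ((f x.1).comp (g x.1) (h x.1)).ext x.2 = ((f x.1).comp (g x.1) (h x.1)).ext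
        (min (max x.2 0) (((f x.1).length : ℝ) + (g x.1).length)) := by
      simp only [MoorePath.ext, Set.IccExtend, Function.comp]
      congr 1
      refine Subtype.ext ?_
      rw [Set.coe_projIcc, Set.coe_projIcc]
      change max 0 (min (((f x.1).length + (g x.1).length : ℕ) : ℝ) _) =
        max 0 (min (((f x.1).length + (g x.1).length : ℕ) : ℝ) _)
      push_cast
      generalize ((f x.1).length : ℝ) + (g x.1).length = c at hp
      rcases le_total x.2 0 with h3 | h3 <;> rcases le_total x.2 c with h4 | h4 <;>
        simp [h3, h4, hp]
      exact le_antisymm (h4.trans h3) hp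
    rw [this]
    have hb0 : 0 ≤ min (max x.2 0) (((f x.1).length : ℝ) + (g x.1).length) :=
      le_min (le_max_right _ _) hp
    have hb1 := min_le_right (max x.2 0) (((f x.1).length : ℝ) + (g x.1).length)
    split_ifs with h5
    · rw [comp_ext_left _ _ _ hb0 h5]
    · rw [comp_ext_right _ _ _ (not_le.1 h5).le hb1]
  rw [key]
  have hm : Continuous fun x : Z × ℝ =>
      min (max x.2 0) (((f x.1).length : ℝ) + (g x.1).length) := by
    have := hc1.comp (continuous_fst (X := Z) (Y := ℝ))
    have := hc2.comp (continuous_fst (X := Z) (Y := ℝ))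
    exact (continuous_snd.max continuous_const).min (by fun_prop)
  refine Continuous.if_le (hf.2.comp (continuous_fst.prodMk hm))
    (hg.2.comp (continuous_fst.prodMk (hm.sub (hc1.comp continuous_fst)))) hm
    (hc1.comp continuous_fst) ?_
  intro x hx
  rw [hx, ext_length, sub_self, ext_zero, h]

end MoorePath

/-- A family of sets of Moore paths of `U` with prescribed endpoints, indexed by pairs of states,
and stable under Moore composition. -/
structure MooreSystem where
  State : Type u
  Carrier : Type u
  [top : TopologicalSpace Carrier]
  point : State → Carrier
  paths : State → State → Set (MoorePath Carrier)
  source_eq : ∀ {a b p}, p ∈ paths a b → p.source = point a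
  target_eq : ∀ {a b p}, p ∈ paths a b → p.target = point b
  comp_mem : ∀ {a b c p q} (hp : p ∈ paths a b) (hq : q ∈ paths b c),
    p.comp q ((target_eq hp).trans (source_eq hq).symm) ∈ paths a c

namespace MooreSystem

attribute [instance] MooreSystem.top

variable (M N : MooreSystem.{u})

/-- The execution paths: the disjoint union over the pairs of states of the sets of paths, each with
the `Δ`-kelleyfication of the topology induced by the space of Moore paths. -/
def Path : Type u := Σ ab : M.State × M.State, DeltaKelley (M.paths ab.1 ab.2)

instance : TopologicalSpace M.Path :=
  inferInstanceAs (TopologicalSpace (Σ ab : M.State × M.State, DeltaKelley (M.paths ab.1 ab.2)))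

instance : DeltaGeneratedSpace M.Path :=
  inferInstanceAs (DeltaGeneratedSpace
    (Σ ab : M.State × M.State, DeltaKelley (M.paths ab.1 ab.2)))

variable {M N}

/-- The execution path given by a Moore path. -/
def Path.mk (a b : M.State) (p : MoorePath M.Carrier) (hp : p ∈ M.paths a b) : M.Path :=
  ⟨(a, b), WithGeneratedByTopology.equiv.symm ⟨p, hp⟩⟩

/-- The Moore path underlying an execution path. -/
def Path.moore (x : M.Path) : MoorePath M.Carrier := (WithGeneratedByTopology.equiv x.2).1

theorem Path.mem (x : M.Path) : x.moore ∈ M.paths x.1.1 x.1.2 :=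
  (WithGeneratedByTopology.equiv x.2).2

theorem Path.eq {x y : M.Path} (h : x.1 = y.1) (h' : x.moore = y.moore) : x = y := by
  obtain ⟨ab, p⟩ := x
  obtain ⟨ab', q⟩ := y
  dsimp at h
  subst h
  exact congrArg (Sigma.mk ab) (Subtype.ext h')

theorem Path.continuous_moore : Continuous (Path.moore (M := M)) :=
  continuous_sigma_iff.2 fun _ =>
    continuous_subtype_val.comp WithGeneratedByTopology.continuous_equiv

theorem Path.isLocallyConstant_fst : IsLocallyConstant fun x : M.Path => x.1 := by
  let : TopologicalSpace (M.State × M.State) := ⊥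
  have : DiscreteTopology (M.State × M.State) := ⟨rfl⟩
  exact (IsLocallyConstant.iff_continuous _).2 (continuous_sigma_iff.2 fun _ => continuous_const)

theorem Path.continuous_of {Z : Type*} [TopologicalSpace Z] [DeltaGeneratedSpace Z]
    {f : Z → M.Path} (h : IsLocallyConstant fun z => (f z).1)
    (h' : Continuous fun z => (f z).moore) : Continuous f := by
  rw [IsGeneratedBy.continuous_iff (X := fun n : ℕ => Fin n → ℝ)]
  intro n g
  have hc : ∀ z, (f (g z)).1 = (f (g 0)).1 := fun z =>
    (h.comp_continuous g.continuous).apply_eq_of_preconnectedSpace z 0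
  have : f ∘ g = fun z => (⟨(f (g 0)).1, WithGeneratedByTopology.equiv.symm
      ⟨(f (g z)).moore, by rw [← hc z]; exact (f (g z)).mem⟩⟩ : M.Path) :=
    funext fun z => Path.eq (hc z) rfl
  rw [this]
  refine continuous_sigmaMk.comp ?_
  refine (IsGeneratedBy.equiv_symm_comp_continuous_iff (X := fun n : ℕ => Fin n → ℝ) _).2 ?_
  exact (h'.comp g.continuous).subtype_mk _

/-- Moore composition of execution paths. -/
def Path.comp (x y : M.Path) (h : x.1.2 = y.1.1) : M.Path :=
  Path.mk x.1.1 y.1.2 (x.moore.comp y.moore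
      ((M.target_eq x.mem).trans (h ▸ (M.source_eq y.mem).symm)))
    (M.comp_mem x.mem (by rw [h]; exact y.mem))

theorem Path.continuous_comp :
    Continuous fun p : DeltaKelley {p : M.Path × M.Path // p.1.1.2 = p.2.1.1} =>
      Path.comp (WithGeneratedByTopology.equiv p).1.1 (WithGeneratedByTopology.equiv p).1.2
        (WithGeneratedByTopology.equiv p).2 :=
  (Flow.continuous_comp_iff (fun x : M.Path => x.1.1) (fun x => x.1.2) Path.comp).2
    fun n a b h ha hb => by
      refine Path.continuous_of ?_ ?_
      · exact ((Path.isLocallyConstant_fst.comp_continuous ha).comp Prod.fst).prodMk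
          ((Path.isLocallyConstant_fst.comp_continuous hb).comp Prod.snd)
      · exact MoorePath.continuous_comp (Path.continuous_moore.comp ha)
          (Path.continuous_moore.comp hb)
          (fun z => (M.target_eq (a z).mem).trans
            ((congrArg M.point (h z)).trans (M.source_eq (b z).mem).symm))

variable (M) in
/-- The flow of a Moore system; its composition is the Moore composition. -/
def flow : Flow.{u} where
  State := M.State
  Path := M.Path
  src := fun x => x.1.1
  tgt := fun x => x.1.2
  isLocallyConstant_src := Path.isLocallyConstant_fst.comp Prod.fst
  isLocallyConstant_tgt := Path.isLocallyConstant_fst.comp Prod.snd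
  comp := Path.comp
  src_comp := fun _ _ _ => rfl
  tgt_comp := fun _ _ _ => rfl
  assoc := fun x y z h h' => Path.eq rfl (MoorePath.comp_assoc x.moore y.moore z.moore
    ((M.target_eq x.mem).trans ((congrArg M.point h).trans (M.source_eq y.mem).symm))
    ((M.target_eq y.mem).trans ((congrArg M.point h').trans (M.source_eq z.mem).symm)))
  continuous_comp := Path.continuous_comp

/-- The effect of a continuous map on execution paths. -/
def Path.map (g : M.State → N.State) (φ : C(M.Carrier, N.Carrier))
    (h : ∀ a b, ∀ p ∈ M.paths a b, p.map φ ∈ N.paths (g a) (g b)) (x : M.Path) : N.Path :=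
  Path.mk (g x.1.1) (g x.1.2) (x.moore.map φ) (h _ _ _ x.mem)

/-- The map of flows induced by a continuous map preserving the given paths. -/
def flowMap (g : M.State → N.State) (φ : C(M.Carrier, N.Carrier))
    (h : ∀ a b, ∀ p ∈ M.paths a b, p.map φ ∈ N.paths (g a) (g b)) : M.flow ⟶ N.flow :=
  { onState := (g :)
    onPath := (Path.map g φ h :)
    continuous_onPath := Path.continuous_of (M := N)
      (Path.isLocallyConstant_fst.comp fun ab => (g ab.1, g ab.2))
      ((MoorePath.continuous_map φ).comp Path.continuous_moore)
    src_onPath := fun _ => rfl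
    tgt_onPath := fun _ => rfl
    onPath_comp := fun x y h => Path.eq (M := N) rfl (MoorePath.map_comp φ _ _
      ((M.target_eq (Path.mem x)).trans
        ((congrArg M.point h).trans (M.source_eq (Path.mem y)).symm))) : Flow.Hom M.flow N.flow }

end MooreSystem

/-- `coface i ε` inserts the value `ε` at position `i`. -/
def coface {n : ℕ} (i : Fin (n + 1)) (ε : Bool) (v : Fin n → Bool) : Fin (n + 1) → Bool :=
  i.insertNth (α := fun _ => Bool) ε v

/-- The set maps `{0,1}^m → {0,1}^n` which are composites of coface maps. -/
inductive IsBoxMap : ∀ {m n : ℕ}, ((Fin m → Bool) → (Fin n → Bool)) → Prop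
  | id (n : ℕ) : IsBoxMap (id : (Fin n → Bool) → (Fin n → Bool))
  | coface_comp {m n : ℕ} {f : (Fin m → Bool) → (Fin n → Bool)} (hf : IsBoxMap f)
      (i : Fin (n + 1)) (ε : Bool) : IsBoxMap (coface i ε ∘ f)

theorem IsBoxMap.comp {l m n : ℕ} {f : (Fin l → Bool) → (Fin m → Bool)}
    {g : (Fin m → Bool) → (Fin n → Bool)} (hg : IsBoxMap g) (hf : IsBoxMap f) :
    IsBoxMap (g ∘ f) := by
  induction hg with
  | id => exact hf
  | coface_comp _ i ε ih => exact ih.coface_comp i ε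

/-- The box category: the object of dimension `n` stands for `{0,1}^n`, the morphisms are the set
maps generated by the cofaces. -/
structure Box where
  dim : ℕ

instance : Category Box where
  Hom m n := {f : (Fin m.dim → Bool) → (Fin n.dim → Bool) // IsBoxMap f}
  id m := ⟨id, .id _⟩
  comp f g := ⟨g.1 ∘ f.1, g.2.comp f.2⟩

theorem Box.hom_ext {m n : Box} {f g : m ⟶ n} (h : f.1 = g.1) : f = g := Subtype.ext h

theorem isBoxMap_const : ∀ {n : ℕ} (α : Fin n → Bool), IsBoxMap fun _ : Fin 0 → Bool => α
  | 0, α => by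
    have : (fun _ : Fin 0 → Bool => α) = id := funext fun _ => Subsingleton.elim _ _
    rw [this]
    exact .id 0
  | n + 1, α => by
    have : (fun _ : Fin 0 → Bool => α) =
        coface 0 (α 0) ∘ fun _ => (Fin.removeNth 0 α : Fin n → Bool) := by
      funext _
      exact (Fin.insertNth_self_removeNth (α := fun _ => Bool) 0 α).symm
    rw [this]
    exact (isBoxMap_const _).coface_comp 0 (α 0)

/-- The morphism `[0] ⟶ [n]` with image the vertex `α`. -/
def Box.vertex {n : ℕ} (α : Fin n → Bool) : Box.mk 0 ⟶ Box.mk n :=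
  ⟨fun _ => α, isBoxMap_const α⟩

/-- The topological cube `[0,1]^n`. -/
abbrev Cube (n : ℕ) : Type u := Fin n → ULift.{u} I

/-- `0` or `1`, in the unit interval. -/
def bit (ε : Bool) : ULift.{u} I := ⟨if ε then 1 else 0⟩

/-- The inclusion `{0,1}^n ⊂ [0,1]^n`. -/
def cubeVertex {n : ℕ} (α : Fin n → Bool) : Cube.{u} n := fun i => bit (α i)

open Classical in
/-- The map `[0,1]^m → [0,1]^n` extending a morphism `f` of the box category: each coordinate of
`f` is either a coordinate of the source, or constant. -/
def cubeMap {m n : ℕ} (f : (Fin m → Bool) → (Fin n → Bool)) (x : Cube.{u} m) : Cube.{u} n :=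
  fun j => if h : ∃ i, ∀ v, f v j = v i then x h.choose else bit (f (fun _ => false) j)

theorem cubeMap_proj {m n : ℕ} {f : (Fin m → Bool) → (Fin n → Bool)} {j : Fin n} {i : Fin m}
    (h : ∀ v, f v j = v i) (x : Cube.{u} m) : cubeMap f x j = x i := by
  have h' : ∃ i, ∀ v, f v j = v i := ⟨i, h⟩
  rw [cubeMap, dif_pos h']
  have := h'.choose_spec
  congr 1
  by_contra hne
  have h1 := (this (fun k => decide (k = i))).symm.trans (h (fun k => decide (k = i)))
  simp [hne] at h1

theorem cubeMap_const {m n : ℕ} {f : (Fin m → Bool) → (Fin n → Bool)} {j : Fin n} {ε : Bool}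
    (h : ∀ v, f v j = ε) (x : Cube.{u} m) : cubeMap f x j = bit ε := by
  rw [cubeMap, dif_neg, h]
  rintro ⟨i, hi⟩
  have h1 := (h fun _ => false).symm.trans (hi _)
  have h2 := (h fun _ => true).symm.trans (hi _)
  rw [h1] at h2
  exact absurd h2 (by simp)

theorem IsBoxMap.coord {m n : ℕ} {f : (Fin m → Bool) → (Fin n → Bool)} (hf : IsBoxMap f)
    (j : Fin n) : (∃ i, ∀ v, f v j = v i) ∨ ∃ ε, ∀ v, f v j = ε := by
  induction hf with
  | id => exact .inl ⟨j, fun _ => rfl⟩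
  | coface_comp _ i ε ih =>
    rcases Fin.eq_self_or_eq_succAbove i j with rfl | ⟨k, rfl⟩
    · exact .inr ⟨ε, fun v => by simp [coface]⟩
    · simpa [coface] using ih k

theorem cubeMap_id (n : ℕ) (x : Cube.{u} n) : cubeMap id x = x :=
  funext fun j => cubeMap_proj (f := id) (i := j) (fun _ => rfl) x

theorem cubeMap_comp {l m n : ℕ} {f : (Fin l → Bool) → (Fin m → Bool)}
    {g : (Fin m → Bool) → (Fin n → Bool)} (hf : IsBoxMap f) (hg : IsBoxMap g) (x : Cube.{u} l) :
    cubeMap (g ∘ f) x = cubeMap g (cubeMap f x) := by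
  funext k
  rcases hg.coord k with ⟨j, hj⟩ | ⟨ε, hε⟩
  · rw [cubeMap_proj hj]
    rcases hf.coord j with ⟨i, hi⟩ | ⟨ε, hε⟩
    · rw [cubeMap_proj hi, cubeMap_proj (f := g ∘ f) fun v => (hj _).trans (hi v)]
    · rw [cubeMap_const hε, cubeMap_const (f := g ∘ f) fun v => (hj _).trans (hε v)]
  · rw [cubeMap_const hε, cubeMap_const (f := g ∘ f) fun v => hε _]

theorem cubeMap_coface {n : ℕ} (i : Fin (n + 1)) (ε : Bool) (x : Cube.{u} n) :
    cubeMap (coface i ε) x = i.insertNth (α := fun _ => ULift.{u} I) (bit ε) x := by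
  funext j
  rcases Fin.eq_self_or_eq_succAbove i j with rfl | ⟨k, rfl⟩
  · rw [cubeMap_const (ε := ε) (fun v => by simp [coface])]
    simp
  · rw [cubeMap_proj (i := k) (fun v => by simp [coface])]
    simp

theorem cubeMap_vertex {m n : ℕ} {f : (Fin m → Bool) → (Fin n → Bool)} (hf : IsBoxMap f)
    (α : Fin m → Bool) : cubeMap.{u} f (cubeVertex α) = cubeVertex (f α) := by
  funext j
  rcases hf.coord j with ⟨i, hi⟩ | ⟨ε, hε⟩
  · rw [cubeMap_proj hi, cubeVertex, cubeVertex, hi]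
  · rw [cubeMap_const hε, cubeVertex, hε]

theorem continuous_cubeMap {m n : ℕ} (f : (Fin m → Bool) → (Fin n → Bool)) :
    Continuous (cubeMap.{u} f) := by
  refine continuous_pi fun j => ?_
  unfold cubeMap
  split_ifs
  · exact continuous_apply _
  · exact continuous_const

theorem cubeMap_mono {m n : ℕ} (f : (Fin m → Bool) → (Fin n → Bool)) :
    Monotone (cubeMap.{u} f) := by
  intro x y h j
  unfold cubeMap
  split_ifs
  · exact h _
  · exact le_rfl

theorem sum_cubeMap {m n : ℕ} {f : (Fin m → Bool) → (Fin n → Bool)} (hf : IsBoxMap f)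
    (x y : Cube.{u} m) :
    ∑ j, (((cubeMap f x j).down : ℝ) - (cubeMap f y j).down) =
      ∑ i, (((x i).down : ℝ) - (y i).down) := by
  induction hf with
  | id => simp [cubeMap_id]
  | @coface_comp n f hf i ε ih =>
    have hc : IsBoxMap (coface i ε) := (IsBoxMap.id _).coface_comp i ε
    rw [← ih, Fin.sum_univ_succAbove _ i]
    simp [cubeMap_comp hf hc, cubeMap_coface]

/-- `cubeMap` as a continuous map. -/
def cubeMapC {m n : ℕ} (f : (Fin m → Bool) → (Fin n → Bool)) : C(Cube.{u} m, Cube.{u} n) :=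
  ⟨cubeMap f, continuous_cubeMap f⟩

/-- The cocubical space `[0,1]^*`. -/
def cubeTop : Box ⥤ TopCat.{u} where
  obj n := TopCat.of (Cube.{u} n.dim)
  map f := TopCat.ofHom (cubeMapC f.1)
  map_id n := by
    refine TopCat.hom_ext (ContinuousMap.ext fun x => ?_)
    exact cubeMap_id _ x
  map_comp f g := by
    refine TopCat.hom_ext (ContinuousMap.ext fun x => ?_)
    exact cubeMap_comp f.2 g.2 x

/-- The nonconstant tame natural `d`-paths of `[0,1]^n` from the vertex `α` to the vertex `β`, i.e. the
tame natural `d`-paths of the subcube from `α` to `β`: they are nondecreasing in each coordinate and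
at time `t` the coordinates have increased by `t` in total. For `α = 0_n` and `β = 1_n` the length is
`n` and the last condition is `t = γ_1(t) + ⋯ + γ_n(t)`; this is the set `N_n`. -/
structure IsNaturalCubePath {n : ℕ} (α β : Fin n → Bool) (p : MoorePath (Cube.{u} n)) : Prop where
  length_pos : 0 < p.length
  source_eq : p.source = cubeVertex α
  target_eq : p.target = cubeVertex β
  monotone : Monotone p.2
  natural : ∀ t, ∑ i, (((p.2 t i).down : ℝ) - (cubeVertex.{u} α i).down) = t

theorem IsNaturalCubePath.map {m n : ℕ} {f : (Fin m → Bool) → (Fin n → Bool)} (hf : IsBoxMap f)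
    {α β : Fin m → Bool} {p : MoorePath (Cube.{u} m)} (hp : IsNaturalCubePath α β p) :
    IsNaturalCubePath (f α) (f β) (p.map (cubeMapC f)) where
  length_pos := hp.length_pos
  source_eq := (congrArg (cubeMap f) hp.source_eq).trans (cubeMap_vertex hf α)
  target_eq := (congrArg (cubeMap f) hp.target_eq).trans (cubeMap_vertex hf β)
  monotone := (cubeMap_mono f).comp hp.monotone
  natural := fun t => by
    rw [← hp.natural t, ← sum_cubeMap hf, cubeMap_vertex hf]
    rfl

theorem IsNaturalCubePath.ext_mono {n : ℕ} {α β : Fin n → Bool} {p : MoorePath (Cube.{u} n)}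
    (hp : IsNaturalCubePath α β p) : Monotone p.ext :=
  hp.monotone.IccExtend _

theorem IsNaturalCubePath.ext_natural {n : ℕ} {α β : Fin n → Bool} {p : MoorePath (Cube.{u} n)}
    (hp : IsNaturalCubePath α β p) {t : ℝ} (h0 : 0 ≤ t) (h1 : t ≤ p.length) :
    ∑ i, (((p.ext t i).down : ℝ) - (cubeVertex.{u} α i).down) = t := by
  rw [p.ext_of_mem ⟨h0, h1⟩]
  exact hp.natural ⟨t, h0, h1⟩

theorem IsNaturalCubePath.of_ext {n : ℕ} {α β : Fin n → Bool} {p : MoorePath (Cube.{u} n)}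
    (hl : 0 < p.length) (hs : p.source = cubeVertex α) (ht : p.target = cubeVertex β)
    (hm : ∀ s t : ℝ, 0 ≤ s → s ≤ t → t ≤ p.length → p.ext s ≤ p.ext t)
    (hn : ∀ t : ℝ, 0 ≤ t → t ≤ p.length →
      ∑ i, (((p.ext t i).down : ℝ) - (cubeVertex.{u} α i).down) = t) :
    IsNaturalCubePath α β p where
  length_pos := hl
  source_eq := hs
  target_eq := ht
  monotone := fun s t h => by
    have := hm s t s.2.1 h t.2.2
    rwa [p.ext_of_mem s.2, p.ext_of_mem t.2] at this
  natural := fun t => by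
    have := hn t t.2.1 t.2.2
    rwa [p.ext_of_mem t.2] at this

theorem IsNaturalCubePath.comp {n : ℕ} {α β γ : Fin n → Bool} {p q : MoorePath (Cube.{u} n)}
    (hp : IsNaturalCubePath α β p) (hq : IsNaturalCubePath β γ q) :
    IsNaturalCubePath α γ (p.comp q (hp.target_eq.trans hq.source_eq.symm)) := by
  have hpl := p.length.cast_nonneg (α := ℝ)
  refine .of_ext (Nat.add_pos_left hp.length_pos _) ((p.comp_source q _).trans hp.source_eq)
    ((p.comp_target q _).trans hq.target_eq) (fun s t h0 h1 h2 => ?_) fun t h0 h1 => ?_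
  · rw [MoorePath.comp_length, Nat.cast_add] at h2
    rcases le_total t p.length with h3 | h3
    · rw [p.comp_ext_left q _ h0 (h1.trans h3), p.comp_ext_left q _ (h0.trans h1) h3]
      exact hp.ext_mono h1
    · rw [p.comp_ext_right q _ h3 h2]
      rcases le_total s p.length with h4 | h4
      · rw [p.comp_ext_left q _ h0 h4]
        refine (hp.ext_mono h4).trans ?_
        rw [p.ext_length, hp.target_eq, ← hq.source_eq, ← q.ext_zero]
        exact hq.ext_mono (sub_nonneg.2 h3)
      · rw [p.comp_ext_right q _ h4 (h1.trans h2)]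
        exact hq.ext_mono (sub_le_sub_right h1 _)
  · rw [MoorePath.comp_length, Nat.cast_add] at h1
    rcases le_total t p.length with h3 | h3
    · rw [p.comp_ext_left q _ h0 h3]
      exact hp.ext_natural h0 h3
    · rw [p.comp_ext_right q _ h3 h1]
      have e1 := hq.ext_natural (sub_nonneg.2 h3) (by linarith)
      have e2 := hp.ext_natural hpl le_rfl
      rw [p.ext_length, hp.target_eq] at e2
      have e3 : t = (t - p.length) + p.length := by ring
      refine Eq.trans ?_ (e3.trans (congrArg₂ (· + ·) e1 e2).symm).symm
      rw [← Finset.sum_add_distrib]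
      refine Finset.sum_congr rfl fun i _ => ?_
      ring

/-- Every natural path of `[0,1]^n` between two vertices is a natural path of a face of the cube,
from the initial to the final vertex of that face. -/
theorem IsNaturalCubePath.exists_face : ∀ {n : ℕ} {α β : Fin n → Bool}
    {p : MoorePath (Cube.{u} n)}, IsNaturalCubePath α β p →
    ∃ (m : ℕ) (φ : Box.mk m ⟶ Box.mk n) (q : MoorePath (Cube.{u} m)),
      IsNaturalCubePath (fun _ => false) (fun _ => true) q ∧ p = q.map (cubeMapC φ.1) := by
  intro n
  induction n with
  | zero =>
    intro α β p hp
    have := hp.natural ⟨p.1, Nat.cast_nonneg _, le_rfl⟩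
    have h2 : (0 : ℝ) < p.1 := Nat.cast_pos.2 hp.length_pos
    simp at this
    exact absurd this.symm (by exact_mod_cast h2.ne')
  | succ n ih =>
    intro α β p hp
    have hle : cubeVertex.{u} α ≤ cubeVertex β := by
      rw [← hp.source_eq, ← hp.target_eq, ← p.ext_zero, ← p.ext_length]
      exact hp.ext_mono (Nat.cast_nonneg _)
    have hle' : ∀ i, α i = true → β i = true := by
      intro i h
      have h1 : bit.{u} (α i) ≤ bit (β i) := hle i
      by_contra h2
      rw [h, Bool.eq_false_iff.2 h2] at h1
      exact absurd (show (1 : I) ≤ 0 from h1) (by simp)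
    by_cases hne : ∀ i, α i ≠ β i
    · have hab : ∀ i, α i = false ∧ β i = true := fun i => by
        have h1 := hne i
        have h2 := hle' i
        revert h1 h2
        cases α i <;> cases β i <;> simp
      obtain rfl : α = fun _ => false := funext fun i => (hab i).1
      obtain rfl : β = fun _ => true := funext fun i => (hab i).2
      exact ⟨n + 1, 𝟙 _, p, hp, (p.map_eq_self (f := cubeMapC id) (cubeMap_id _)).symm⟩
    · push Not at hne
      obtain ⟨i, hi⟩ := hne
      have hc : ∀ t, p.2 t i = bit (α i) := by
        intro t
        refine le_antisymm ?_ ?_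
        · have := hp.monotone (show t ≤ ⟨p.1, Nat.cast_nonneg _, le_rfl⟩ from t.2.2) i
          rw [show p.2 ⟨p.1, Nat.cast_nonneg _, le_rfl⟩ = cubeVertex β from hp.target_eq] at this
          rw [hi]
          exact this
        · have := hp.monotone (show ⟨0, le_rfl, Nat.cast_nonneg _⟩ ≤ t from t.2.1) i
          rw [show p.2 ⟨0, le_rfl, Nat.cast_nonneg _⟩ = cubeVertex α from hp.source_eq] at this
          exact this
      let r : C(Cube.{u} (n + 1), Cube.{u} n) := ⟨fun x j => x (i.succAbove j), by fun_prop⟩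
      have hr : IsNaturalCubePath (fun j => α (i.succAbove j)) (fun j => β (i.succAbove j))
          (p.map r) := by
        refine ⟨hp.length_pos, ?_, ?_, fun s t h j => hp.monotone h _, fun t => ?_⟩
        · exact congrArg r hp.source_eq
        · exact congrArg r hp.target_eq
        · have := hp.natural t
          rw [Fin.sum_univ_succAbove _ i, hc t] at this
          simp only [cubeVertex, sub_self, zero_add] at this
          exact this
      obtain ⟨m, φ, q, hq, hpq⟩ := ih hr
      let δ : Box.mk n ⟶ Box.mk (n + 1) :=
        ⟨coface i (α i), (IsBoxMap.id n).coface_comp i (α i)⟩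
      refine ⟨m, φ ≫ δ, q, hq, ?_⟩
      have h1 : q.map (cubeMapC (φ ≫ δ).1) = (q.map (cubeMapC φ.1)).map (cubeMapC δ.1) :=
        MoorePath.map_congr (f := cubeMapC (δ.1 ∘ φ.1)) (g := (cubeMapC δ.1).comp (cubeMapC φ.1))
          (fun x => cubeMap_comp φ.2 δ.2 x) q
      rw [h1, ← hpq]
      refine MoorePath.eq_of_ext rfl fun t h0 h2 => ?_
      rw [MoorePath.map_ext, MoorePath.map_ext, p.ext_of_mem ⟨h0, h2⟩]
      refine Eq.trans ?_ (cubeMap_coface i (α i) (r (p.2 ⟨t, h0, h2⟩))).symm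
      rw [← hc ⟨t, h0, h2⟩]
      exact (Fin.insertNth_self_removeNth (α := fun _ => ULift.{u} I) i (p.2 ⟨t, h0, h2⟩)).symm

/-- The data of the natural `n`-cube: the states are the vertices of the `n`-cube and the paths from
`α` to `β` are the tame natural `d`-paths of the subcube from `α` to `β` (there is none unless
`α < β`). -/
def natCubeSystem (n : ℕ) : MooreSystem.{u} where
  State := ULift (Fin n → Bool)
  Carrier := Cube.{u} n
  point := fun α => cubeVertex α.down
  paths := fun α β => {p | IsNaturalCubePath α.down β.down p}
  source_eq := fun h => h.source_eq
  target_eq := fun h => h.target_eq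
  comp_mem := fun hp hq => hp.comp hq

/-- The cocubical flow `|□[*]|_nat`. -/
def natCube : Box ⥤ Flow.{u} where
  obj n := (natCubeSystem n.dim).flow
  map f := MooreSystem.flowMap (fun α => ⟨f.1 α.down⟩) (cubeMapC f.1)
    fun _ _ _ hp => IsNaturalCubePath.map f.2 hp
  map_id _ := Flow.hom_ext rfl (funext fun x => MooreSystem.Path.eq rfl
    (MoorePath.map_eq_self (cubeMap_id _) (MooreSystem.Path.moore x)))
  map_comp f g := Flow.hom_ext rfl (funext fun x => MooreSystem.Path.eq rfl
    (MoorePath.map_congr (f := cubeMapC (g.1 ∘ f.1)) (g := (cubeMapC g.1).comp (cubeMapC f.1))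
      (fun y => cubeMap_comp f.2 g.2 y) (MooreSystem.Path.moore x)))

/-- Precubical sets: presheaves on the box category. -/
abbrev PrecubicalSet : Type (u + 1) := Boxᵒᵖ ⥤ Type u

namespace PrecubicalSet

variable (K : PrecubicalSet.{u})

/-- The set of `n`-cubes. -/
abbrev Cell (n : ℕ) : Type u := K.obj (op (Box.mk n))

/-- The category of the maps `□[n] → K`, with its projection to the box category. -/
abbrev cubes : K.Elementsᵒᵖ ⥤ Box := (CategoryOfElements.π K).leftOp

/-- The object `c : □[n] → K` of the category of cubes of `K`. -/
abbrev cube {n : ℕ} (c : K.Cell n) : K.Elementsᵒᵖ := op (K.elementsMk (op (Box.mk n)) c)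

/-- The geometric realization `|K|_geom`, the colimit of the cubes `[0,1]^n` over all `□[n] → K`. -/
def geom : TopCat.{u} := colimit (K.cubes ⋙ cubeTop)

/-- `|c|_geom : [0,1]^n → |K|_geom`. -/
def cellMap {n : ℕ} (c : K.Cell n) : C(Cube.{u} n, K.geom) :=
  (colimit.ι (K.cubes ⋙ cubeTop.{u}) (K.cube c)).hom

theorem cellMap_face {m n : ℕ} (c : K.Cell n) (φ : Box.mk m ⟶ Box.mk n) (x : Cube.{u} m) :
    K.cellMap (K.map φ.op c) x = K.cellMap c (cubeMap φ.1 x) := by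
  let f : K.cube (K.map φ.op c) ⟶ K.cube c :=
    (CategoryOfElements.homMk (K.elementsMk _ c) (K.elementsMk _ (K.map φ.op c)) φ.op rfl).op
  exact (congrArg (fun g => g.hom x) (colimit.w (K.cubes ⋙ cubeTop.{u}) f)).symm

/-- The point of `|K|_geom` given by a vertex of `K`. -/
def vertexPoint (v : K.Cell 0) : K.geom := K.cellMap v (fun i => i.elim0)

theorem cellMap_vertex {n : ℕ} (c : K.Cell n) (α : Fin n → Bool) :
    K.cellMap c (cubeVertex α) = K.vertexPoint (K.map (Box.vertex α).op c) := by
  rw [vertexPoint, cellMap_face]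
  exact congrArg (K.cellMap c) (funext fun j => (cubeMap_const (fun _ => rfl) _).symm)

/-- The nonconstant tame natural `d`-paths of `|K|_geom`: the Moore compositions
`[c₁;γ₁] * ⋯ * [c_p;γ_p]`, `p ≥ 1`, where `γᵢ` is a tame natural `d`-path of the cube `cᵢ` from its
initial to its final vertex. -/
inductive IsTameNatural : MoorePath K.geom → Prop
  | cube {n : ℕ} (c : K.Cell n) (γ : MoorePath (Cube.{u} n))
      (hγ : IsNaturalCubePath (fun _ => false) (fun _ => true) γ) :
      IsTameNatural (γ.map (K.cellMap c))
  | comp (p q : MoorePath K.geom) (h : p.target = q.source) (hp : IsTameNatural p)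
      (hq : IsTameNatural q) : IsTameNatural (p.comp q h)

theorem IsTameNatural.of_face {n : ℕ} (c : K.Cell n) {α β : Fin n → Bool}
    {p : MoorePath (Cube.{u} n)} (hp : IsNaturalCubePath α β p) :
    K.IsTameNatural (p.map (K.cellMap c)) := by
  obtain ⟨m, φ, q, hq, rfl⟩ := hp.exists_face
  have : (q.map (cubeMapC φ.1)).map (K.cellMap c) = q.map (K.cellMap (K.map φ.op c)) :=
    MoorePath.map_congr (f := (K.cellMap c).comp (cubeMapC φ.1))
      (fun x => (K.cellMap_face c φ x).symm) q
  rw [this]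
  exact .cube _ _ hq

/-- The tame natural `d`-paths from `α` to `β`. -/
def tamePaths (α β : K.Cell 0) : Set (MoorePath K.geom) :=
  {p | K.IsTameNatural p ∧ p.source = K.vertexPoint α ∧ p.target = K.vertexPoint β}

/-- The data of the tame concrete realization. -/
def tcSystem : MooreSystem.{u} where
  State := K.Cell 0
  Carrier := K.geom
  point := K.vertexPoint
  paths := K.tamePaths
  source_eq := fun h => h.2.1
  target_eq := fun h => h.2.2
  comp_mem := fun {_ _ _ p q} hp hq => ⟨.comp p q _ hp.1 hq.1,
    (p.comp_source q _).trans hp.2.1, (p.comp_target q _).trans hq.2.2⟩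

/-- The tame concrete realization `|K|_tc`. -/
def tcFlow : Flow.{u} := K.tcSystem.flow

/-- The natural realization `|K|_nat`, the colimit in flows of the natural cubes over all
`□[n] → K`. -/
def natFlow : Flow.{u} := colimit (K.cubes ⋙ natCube)

theorem map_mem_tamePaths {n : ℕ} (c : K.Cell n) (α β : Fin n → Bool)
    (p : MoorePath (Cube.{u} n)) (hp : IsNaturalCubePath α β p) :
    p.map (K.cellMap c) ∈
      K.tamePaths (K.map (Box.vertex α).op c) (K.map (Box.vertex β).op c) :=
  ⟨.of_face K c hp, by rw [MoorePath.map_source, hp.source_eq, cellMap_vertex],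
    by rw [MoorePath.map_target, hp.target_eq, cellMap_vertex]⟩

/-- The map of flows `|□[n]|_nat → |K|_tc` given by an `n`-cube `c` of `K`: it takes `γ` to
`|c|_geom ∘ γ`. -/
def cubeToTc {n : ℕ} (c : K.Cell n) : natCube.{u}.obj (Box.mk n) ⟶ K.tcFlow :=
  MooreSystem.flowMap (M := natCubeSystem n) (N := K.tcSystem)
    (fun α => K.map (Box.vertex α.down).op c) (K.cellMap c)
    fun _ _ _ hp => K.map_mem_tamePaths c _ _ _ hp

theorem cubeToTc_face {m n : ℕ} (c : K.Cell n) (φ : Box.mk m ⟶ Box.mk n) :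
    natCube.map φ ≫ K.cubeToTc c = K.cubeToTc (K.map φ.op c) := by
  have hs : ∀ α : Fin m → Bool, K.map (Box.vertex (φ.1 α)).op c =
      K.map (Box.vertex α).op (K.map φ.op c) := fun α => by
    have : Box.vertex (φ.1 α) = Box.vertex α ≫ φ := rfl
    rw [this, op_comp, K.map_comp]
    rfl
  refine Flow.hom_ext (funext fun α => hs α.down) (funext fun x => ?_)
  refine MooreSystem.Path.eq (M := K.tcSystem) (Prod.ext (hs _) (hs _)) ?_
  exact MoorePath.map_congr (f := (K.cellMap c).comp (cubeMapC φ.1))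
    (fun y => (K.cellMap_face c φ y).symm) (MooreSystem.Path.moore x)

/-- The maps `cubeToTc` form a cocone. -/
def tcCocone : Cocone (K.cubes ⋙ natCube.{u}) where
  pt := K.tcFlow
  ι :=
    { app := fun x => K.cubeToTc x.unop.2
      naturality := fun x y f => by
        have := K.cubeToTc_face y.unop.2 f.unop.1.unop
        refine Eq.trans this ?_
        refine Eq.trans ?_ (Category.comp_id _).symm
        exact congrArg K.cubeToTc f.unop.2 }

/-- The natural map of flows `|K|_nat → |K|_tc`. -/
def natToTc : K.natFlow ⟶ K.tcFlow := colimit.desc (K.cubes ⋙ natCube.{u}) K.tcCocone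

/-- A vertex of `K`, as a state of `|K|_tc`. -/
def tcState (v : K.Cell 0) : K.tcFlow.State := v

/-- A vertex of `K`, as a state of `|K|_nat`. -/
def natState (v : K.Cell 0) : K.natFlow.State :=
  (colimit.ι (K.cubes ⋙ natCube.{u}) (K.cube v)).onState ⟨fun i => i.elim0⟩

theorem natToTc_natState (v : K.Cell 0) : K.natToTc.onState (K.natState v) = K.tcState v := by
  have h := colimit.ι_desc K.tcCocone (K.cube v)
  refine (congrFun (congrArg Flow.Hom.onState h) ⟨fun i => i.elim0⟩).trans ?_
  have : Box.vertex (fun i : Fin 0 => i.elim0) = 𝟙 _ :=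
    Box.hom_ext (funext fun _ => Subsingleton.elim _ _)
  change K.map (Box.vertex (fun i : Fin 0 => i.elim0)).op v = v
  rw [this, op_id, K.map_id]
  rfl

/-- The map `P_{α,β}|K|_nat → P_{α,β}|K|_tc` induced by the natural map of flows. -/
def natToTcPath (α β : K.Cell 0) (x : K.natFlow.PathSpace (K.natState α) (K.natState β)) :
    K.tcFlow.PathSpace (K.tcState α) (K.tcState β) :=
  ⟨K.natToTc.onPath x.1,
    by rw [Flow.Hom.src_onPath, x.2.1, natToTc_natState],
    by rw [Flow.Hom.tgt_onPath, x.2.2, natToTc_natState]⟩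

/-- Spatial precubical sets. -/
def Spatial : Prop :=
  ∀ α β : K.Cell 0, Function.Bijective (K.natToTcPath α β)

end PrecubicalSet

end Precubical

end

noncomputable section

/-! The natural map is continuous and, by spatiality, bijective, so only the continuity of its
inverse is at stake. The execution paths of `tcFlow` form a `Δ`-generated space, hence it is enough
to lift: a map `g` from `ℝⁿ` to the execution paths of `natFlow` is continuous as soon as its
composite with the natural map is (`continuous_lift`). A colimit topology gives no direct control
over maps into it; compactness supplies it.

Near a point `z` of `ℝⁿ` the paths have constant length and sweep a compact part of `|K|_geom`,
which meets finitely many open cells (`finite_cellOf_image`). The heart of the proof is that the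
execution paths of `natFlow` of a given length, meeting only finitely many given open cells, are
covered by finitely many compact sets (`finitelyCharted_pathsIn`). These sets come from the path
spaces `N_n`, which are compact by Arzelà–Ascoli, and from their composites. Two difficulties arise.
Infinitely many cubes of `K` can carry paths that run through a few shared faces; spatiality
identifies execution paths with the same image in `|K|_geom`, so that only the finitely many
configurations of met faces count (`natPath_eq_of_metFaces`). Moreover, composition in a flow is
continuous only for the `Δ`-kelleyfied fibre product; as `N_n` is convex, products of such spaces
are already `Δ`-generated (`Convex.deltaGeneratedSpace`), and composites of charts are charts
(`Flow.IsChart.comp`).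

Along an ultrafilter converging to `z`, the map `g` therefore has some limit `a`. Limits in
`|K|_geom` are unique for what stays in finitely many closed cells (`limit_unique`), so `a` and `g
z` have the same image in `|K|_geom`, and spatiality gives `a = g z`. -/

namespace Precubical

/-! ### Convex sets are `Δ`-generated -/

section Convex

variable {E : Type*} [NormedAddCommGroup E] [NormedSpace ℝ E]

/-- The piecewise affine map `ℝ → E` through the points of a sequence. -/
def polygonal (x : ℕ → E) (u : ℝ) : E :=
  AffineMap.lineMap (x ⌊u⌋.toNat) (x (⌊u⌋ + 1).toNat) (Int.fract u)

/-- The right endpoint is included because consecutive affine pieces agree there; this makes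
`polygonal` a gluing along a locally finite closed cover. -/
theorem polygonal_of_mem (x : ℕ → E) {k : ℤ} {u : ℝ} (hu : u ∈ Set.Icc (k : ℝ) (k + 1)) :
    polygonal x u = AffineMap.lineMap (x k.toNat) (x (k + 1).toNat) (u - k) := by
  rcases hu.2.lt_or_eq with h | h
  · have : ⌊u⌋ = k := Int.floor_eq_iff.2 ⟨hu.1, h⟩
    rw [polygonal, Int.fract, this]
  · have : ⌊u⌋ = k + 1 := Int.floor_eq_iff.2 ⟨by push_cast; linarith, by push_cast; linarith⟩
    rw [polygonal, Int.fract, this, h]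
    simp

theorem continuous_polygonal (x : ℕ → E) : Continuous (polygonal x) := by
  have hl : LocallyFinite fun k : ℤ => Set.Icc (k : ℝ) (k + 1) := by
    intro u
    refine ⟨Set.Ioo (u - 1) (u + 1), Ioo_mem_nhds (by linarith) (by linarith),
      (Set.finite_Icc (⌊u⌋ - 2) (⌊u⌋ + 2)).subset ?_⟩
    rintro k ⟨y, ⟨h1, h2⟩, h3, h4⟩
    have h5 := Int.floor_le u
    have h6 := Int.lt_floor_add_one u
    constructor
    · have : ((⌊u⌋ - 2 : ℤ) : ℝ) ≤ k := by push_cast; linarith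
      exact_mod_cast this
    · have : (k : ℝ) ≤ ((⌊u⌋ + 2 : ℤ) : ℝ) := by push_cast; linarith
      exact_mod_cast this
  refine hl.continuous (Set.eq_univ_of_forall fun u => Set.mem_iUnion.2
    ⟨⌊u⌋, Int.floor_le u, (Int.lt_floor_add_one u).le⟩) (fun k => isClosed_Icc) fun k => ?_
  have : Continuous fun u : ℝ =>
      AffineMap.lineMap (k := ℝ) (x k.toNat) (x (k + 1).toNat) (u - k) := by
    simp only [AffineMap.lineMap_apply]
    fun_prop
  exact this.continuousOn.congr fun u hu => polygonal_of_mem x hu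

theorem polygonal_mem {s : Set E} (hs : Convex ℝ s) {x : ℕ → E} {N : ℕ} (hx : ∀ k ≥ N, x k ∈ s)
    {u : ℝ} (hu : N ≤ u) : polygonal x u ∈ s := by
  have h0 : (N : ℤ) ≤ ⌊u⌋ := Int.le_floor.2 (by exact_mod_cast hu)
  refine hs.lineMap_mem (hx _ (by omega)) (hx _ (by omega))
    ⟨Int.fract_nonneg u, (Int.fract_lt_one u).le⟩

theorem polygonal_natCast (x : ℕ → E) (k : ℕ) : polygonal x k = x k := by
  simp [polygonal]

/-- Balls are convex, so the curve enters a ball about the limit once the sequence has entered it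
for good. -/
theorem tendsto_polygonal {x : ℕ → E} {a : E} (hx : Filter.Tendsto x Filter.atTop (𝓝 a)) :
    Filter.Tendsto (polygonal x) Filter.atTop (𝓝 a) := by
  rw [Metric.nhds_basis_ball.tendsto_right_iff] at hx ⊢
  intro ε hε
  obtain ⟨N, hN⟩ := Filter.eventually_atTop.1 (hx ε hε)
  filter_upwards [Filter.eventually_ge_atTop (N : ℝ)] with u hu
  exact polygonal_mem (convex_ball a ε) hN hu

/-- A convergent sequence of a convex set is carried by a curve. -/
theorem exists_curve {s : Set E} (hs : Convex ℝ s) {x : ℕ → s} {a : s}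
    (hx : Filter.Tendsto x Filter.atTop (𝓝 a)) :
    ∃ ω : C(ℝ, s), ω 0 = a ∧ ∀ k : ℕ, ω ((k : ℝ) + 1)⁻¹ = x (k + 1) := by
  let y : ℕ → E := fun k => x k
  have hy : Filter.Tendsto y Filter.atTop (𝓝 (a : E)) :=
    (continuous_subtype_val.tendsto a).comp hx
  -- The substitution `u = t⁻¹` brings the end at infinity of the polygonal curve to `t = 0`, where
  -- the value is the limit `a`.
  let τ : ℝ → E := fun t => if t ≤ 0 then a else polygonal y t⁻¹
  have hτ : ∀ t, τ t ∈ s := fun t => by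
    by_cases h : t ≤ 0
    · simp only [τ, if_pos h]; exact a.2
    · simp only [τ, if_neg h]
      exact polygonal_mem hs (N := 0) (fun k _ => (x k).2)
        (by simpa using (not_le.1 h).le)
  have hc : Continuous τ := by
    rw [continuous_iff_continuousAt]
    intro t
    rcases lt_trichotomy t 0 with h | rfl | h
    · refine (continuousAt_const (y := (a : E))).congr ?_
      filter_upwards [Iio_mem_nhds h] with r hr
      exact (if_pos (le_of_lt hr)).symm
    · have h0 : τ 0 = a := if_pos le_rfl
      rw [ContinuousAt, h0, ← nhdsLE_sup_nhdsGT (0 : ℝ)]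
      refine Filter.Tendsto.sup ?_ ?_
      · refine tendsto_const_nhds.congr' ?_
        filter_upwards [self_mem_nhdsWithin] with r hr
        exact (if_pos hr).symm
      · refine ((tendsto_polygonal hy).comp tendsto_inv_nhdsGT_zero).congr' ?_
        filter_upwards [self_mem_nhdsWithin] with r hr
        exact (if_neg (not_le.2 hr)).symm
    · refine ContinuousAt.congr (f := fun t => polygonal y t⁻¹)
        ((continuous_polygonal y).continuousAt.comp (continuousAt_inv₀ h.ne')) ?_
      filter_upwards [Ioi_mem_nhds h] with r hr
      exact (if_neg (not_le.2 hr)).symm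
  refine ⟨⟨fun t => ⟨τ t, hτ t⟩, hc.subtype_mk _⟩, Subtype.ext (if_pos le_rfl), fun k => ?_⟩
  have hk : ¬ ((k : ℝ) + 1)⁻¹ ≤ 0 := not_le.2 (by positivity)
  refine Subtype.ext ((if_neg hk).trans ?_)
  rw [inv_inv, ← Nat.cast_succ, polygonal_natCast]

/-- A metrizable space is sequential, and a convergent sequence with its limit lies on a curve
inside the convex set; hence the maps from `ℝ` alone already detect the topology. -/
theorem _root_.Convex.deltaGeneratedSpace {s : Set E} (hs : Convex ℝ s) :
    DeltaGeneratedSpace s := by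
  constructor
  refine SeqContinuous.continuous fun x a hx => ?_
  obtain ⟨ω, h0, hw⟩ := exists_curve hs hx
  have hc : Continuous fun t : Fin 1 → ℝ =>
      (WithGeneratedByTopology.equiv (X := fun n : ℕ => Fin n → ℝ)).symm (ω (t 0)) :=
    (IsGeneratedBy.equiv_symm_comp_continuous_iff (X := fun n : ℕ => Fin n → ℝ)
      (fun t : Fin 1 → ℝ => ω (t 0))).2 (by fun_prop)
  -- The curve passes through `x (k + 1)` at time `(k + 1)⁻¹`, so the first term is dropped.
  rw [← Filter.tendsto_add_atTop_iff_nat 1]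
  have hl : Filter.Tendsto (fun k : ℕ => fun _ : Fin 1 => ((k : ℝ) + 1)⁻¹) Filter.atTop
      (𝓝 fun _ => 0) := by
    refine tendsto_pi_nhds.2 fun _ => ?_
    simpa using tendsto_one_div_add_atTop_nhds_zero_nat (𝕜 := ℝ)
  have := (hc.tendsto (fun _ => 0)).comp hl
  simpa [Function.comp_def, h0, hw] using this

end Convex

/-! ### The space of natural paths of a cube -/

/-- The natural paths of the `n`-cube from the initial to the final vertex, as a set of continuous
maps to `ℝⁿ`. -/
def naturalPaths (n : ℕ) : Set C(Set.Icc (0 : ℝ) n, Fin n → ℝ) :=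
  {γ | (∀ t i, γ t i ∈ Set.Icc (0 : ℝ) 1) ∧ Monotone γ ∧ ∀ t, ∑ i, γ t i = t}

theorem convex_naturalPaths (n : ℕ) : Convex ℝ (naturalPaths n) := by
  rintro γ ⟨h1, h2, h3⟩ δ ⟨k1, k2, k3⟩ a b ha hb hab
  refine ⟨fun t i => convex_Icc (0 : ℝ) 1 (h1 t i) (k1 t i) ha hb hab, fun s t hst i => ?_,
    fun t => ?_⟩
  · exact add_le_add (mul_le_mul_of_nonneg_left (h2 hst i) ha)
      (mul_le_mul_of_nonneg_left (k2 hst i) hb)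
  · change ∑ i, (a * γ t i + b * δ t i) = _
    rw [Finset.sum_add_distrib, ← Finset.mul_sum, ← Finset.mul_sum, h3, k3, ← add_mul, hab, one_mul]

/-- Each coordinate increment is nonnegative and the increments add up to the elapsed time, so none
exceeds it. -/
theorem dist_le_of_monotone {n : ℕ} {γ : Set.Icc (0 : ℝ) n → Fin n → ℝ} (h2 : Monotone γ)
    (h3 : ∀ t, ∑ i, γ t i = t) (s t : Set.Icc (0 : ℝ) n) : dist (γ s) (γ t) ≤ dist s t := by
  wlog hst : s ≤ t generalizing s t
  · rw [dist_comm, dist_comm s]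
    exact this t s (le_of_not_ge hst)
  refine (dist_pi_le_iff dist_nonneg).2 fun i => ?_
  rw [dist_comm, dist_comm s, Real.dist_eq, abs_of_nonneg (sub_nonneg.2 (h2 hst i)),
    Subtype.dist_eq, Real.dist_eq,
    abs_of_nonneg (show (0 : ℝ) ≤ t - s from sub_nonneg.2 hst), ← h3, ← h3,
    ← Finset.sum_sub_distrib]
  exact Finset.single_le_sum (f := fun i => γ t i - γ s i)
    (fun j _ => sub_nonneg.2 (h2 hst j)) (Finset.mem_univ i)

/-- Arzelà–Ascoli: natural paths are all 1-Lipschitz. The set is closed for pointwise convergence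
because a function satisfying the three pointwise conditions is automatically 1-Lipschitz, hence
continuous. -/
theorem isCompact_naturalPaths (n : ℕ) : IsCompact (naturalPaths n) := by
  refine ArzelaAscoli.isCompact_of_equicontinuous _ ?_ ?_
  · have : ContinuousMap.toFun '' naturalPaths n =
        {γ : Set.Icc (0 : ℝ) n → Fin n → ℝ | (∀ t i, γ t i ∈ Set.Icc (0 : ℝ) 1) ∧
          (∀ s t, s ≤ t → ∀ i, γ s i ≤ γ t i) ∧ ∀ t, ∑ i, γ t i = t} := by
      ext γ
      constructor
      · rintro ⟨γ, h, rfl⟩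
        exact ⟨h.1, fun s t hst i => h.2.1 hst i, h.2.2⟩
      · rintro ⟨h1, h2, h3⟩
        have hl : LipschitzWith 1 γ := LipschitzWith.of_dist_le_mul fun s t => by
          simpa using dist_le_of_monotone (fun s t hst i => h2 s t hst i) h3 s t
        exact ⟨⟨γ, hl.continuous⟩, ⟨h1, fun s t hst i => h2 s t hst i, h3⟩, rfl⟩
    rw [this]
    refine IsCompact.of_isClosed_subset
      (isCompact_univ_pi fun _ => isCompact_univ_pi fun _ => isCompact_Icc (a := (0 : ℝ)) (b := 1))
      ?_ fun γ h t _ i _ => h.1 t i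
    simp only [Set.ofPred_and, Set.ofPred_forall]
    refine IsClosed.inter ?_ (IsClosed.inter ?_ ?_)
    · exact isClosed_iInter fun t => isClosed_iInter fun i =>
        isClosed_Icc.preimage (by fun_prop)
    · exact isClosed_iInter fun s => isClosed_iInter fun t => isClosed_iInter fun _ =>
        isClosed_iInter fun i => isClosed_le (by fun_prop) (by fun_prop)
    · exact isClosed_iInter fun t => isClosed_eq (by fun_prop) continuous_const
  · refine (LipschitzWith.uniformEquicontinuous _ 1 fun γ => ?_).equicontinuous
    refine LipschitzWith.of_dist_le_mul fun s t => ?_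
    simpa using dist_le_of_monotone γ.2.2.1 γ.2.2.2 s t

/-- The Moore path of the cube given by a natural path. -/
def toMoore {n : ℕ} (γ : naturalPaths n) : MoorePath (Cube.{u} n) :=
  ⟨n, ⟨fun t i => ⟨⟨γ.1 t i, γ.2.1 t i⟩⟩, by fun_prop⟩⟩

theorem continuous_toMoore (n : ℕ) : Continuous (toMoore.{u} (n := n)) := by
  refine continuous_sigmaMk.comp (ContinuousMap.continuous_of_continuous_uncurry _ ?_)
  refine continuous_pi fun i => continuous_uliftUp.comp (Continuous.subtype_mk ?_ _)
  exact (continuous_apply i).comp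
    (continuous_eval.comp ((continuous_subtype_val).prodMap continuous_id))

theorem cubeVertex_false {n : ℕ} (i : Fin n) :
    ((cubeVertex.{u} (fun _ : Fin n => false) i).down : ℝ) = 0 := by
  simp [cubeVertex, bit]

theorem cubeVertex_true {n : ℕ} (i : Fin n) :
    ((cubeVertex.{u} (fun _ : Fin n => true) i).down : ℝ) = 1 := by
  simp [cubeVertex, bit]

/-- The endpoints are forced: coordinates in `[0,1]` with sum `0` all vanish, and those with sum `n`
all equal `1`. -/
theorem isNaturalCubePath_toMoore {n : ℕ} (hn : 0 < n) (γ : naturalPaths n) :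
    IsNaturalCubePath (fun _ => false) (fun _ => true) (toMoore.{u} γ) where
  length_pos := hn
  source_eq := by
    have h := γ.2.2.2 ⟨0, le_rfl, Nat.cast_nonneg _⟩
    rw [Finset.sum_eq_zero_iff_of_nonneg fun i _ => (γ.2.1 _ i).1] at h
    refine funext fun i => ULift.ext _ _ (Subtype.ext ?_)
    rw [cubeVertex_false]
    exact h i (Finset.mem_univ i)
  target_eq := by
    have h := γ.2.2.2 ⟨n, Nat.cast_nonneg _, le_rfl⟩
    have h' : ∑ i, (1 - γ.1 ⟨n, Nat.cast_nonneg _, le_rfl⟩ i) = 0 := by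
      rw [Finset.sum_sub_distrib, h]; simp
    rw [Finset.sum_eq_zero_iff_of_nonneg fun i _ => sub_nonneg.2 (γ.2.1 _ i).2] at h'
    refine funext fun i => ULift.ext _ _ (Subtype.ext ?_)
    rw [cubeVertex_true]
    exact (sub_eq_zero.1 (h' i (Finset.mem_univ i))).symm
  monotone := fun s t hst i => γ.2.2.1 hst i
  natural := fun t => by
    simp only [cubeVertex_false, sub_zero]
    exact γ.2.2.2 t

theorem IsNaturalCubePath.length_eq {n : ℕ} {p : MoorePath (Cube.{u} n)}
    (hp : IsNaturalCubePath (fun _ => false) (fun _ => true) p) : p.length = n := by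
  have := hp.ext_natural p.length.cast_nonneg le_rfl
  rw [p.ext_length, hp.target_eq] at this
  simp only [cubeVertex_false, cubeVertex_true] at this
  simpa using this.symm

theorem IsNaturalCubePath.exists_toMoore {n : ℕ} {p : MoorePath (Cube.{u} n)}
    (hp : IsNaturalCubePath (fun _ => false) (fun _ => true) p) :
    ∃ γ : naturalPaths n, toMoore γ = p := by
  obtain ⟨ℓ, f⟩ := p
  obtain rfl : ℓ = n := hp.length_eq
  refine ⟨⟨⟨fun t i => (f t i).down, by fun_prop⟩, fun t i => (f t i).down.2,
    fun s t hst i => hp.monotone hst i, fun t => ?_⟩, rfl⟩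
  have := hp.natural t
  simp only [cubeVertex_false, sub_zero] at this
  exact this

/-! ### The faces of a cube -/

/-- The points of the open cube. -/
def IsInner {n : ℕ} (x : Cube.{u} n) : Prop := ∀ i ε, x i ≠ bit ε

theorem exists_inner : ∀ {n : ℕ} (x : Cube.{u} n),
    ∃ (m : ℕ) (φ : Box.mk m ⟶ Box.mk n) (y : Cube.{u} m), IsInner y ∧ cubeMap φ.1 y = x
  -- The 0-cube has no coordinates, so its only point is inner.
  | 0, x => ⟨0, 𝟙 _, x, fun i => i.elim0, cubeMap_id 0 x⟩
  | n + 1, x => by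
    by_cases h : IsInner x
    · exact ⟨n + 1, 𝟙 _, x, h, cubeMap_id _ x⟩
    · simp only [IsInner, not_forall, not_not] at h
      obtain ⟨i, ε, h⟩ := h
      obtain ⟨m, φ, y, hy, hx⟩ := exists_inner (i.removeNth x)
      have hc : IsBoxMap (coface i ε) := (IsBoxMap.id n).coface_comp i ε
      refine ⟨m, ⟨coface i ε ∘ φ.1, hc.comp φ.2⟩, y, hy, ?_⟩
      rw [cubeMap_comp φ.2 hc, hx, cubeMap_coface, ← h]
      exact Fin.insertNth_self_removeNth (α := fun _ => ULift.{u} I) i x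

/-- Normal form of a face: the free coordinates, listed in order, and constants elsewhere. -/
theorem IsBoxMap.exists_strictMono {m n : ℕ} {f : (Fin m → Bool) → (Fin n → Bool)}
    (hf : IsBoxMap f) : ∃ s : Fin m → Fin n, StrictMono s ∧ (∀ v i, f v (s i) = v i) ∧
      ∀ j ∉ Set.range s, ∃ ε, ∀ v, f v j = ε := by
  induction hf with
  | id => exact ⟨fun i => i, strictMono_id, fun _ _ => rfl, fun j hj => (hj ⟨j, rfl⟩).elim⟩
  | coface_comp _ i ε ih =>
    obtain ⟨s, hs, h1, h2⟩ := ih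
    refine ⟨fun k => i.succAbove (s k), (Fin.strictMono_succAbove i).comp hs,
      fun v k => by simp [coface, h1], fun j hj => ?_⟩
    rcases Fin.eq_self_or_eq_succAbove i j with rfl | ⟨k, rfl⟩
    · exact ⟨ε, fun v => by simp [coface]⟩
    · obtain ⟨δ, h⟩ := h2 k fun ⟨l, hl⟩ => hj ⟨l, congrArg _ hl⟩
      exact ⟨δ, fun v => by simp [coface, h]⟩

theorem IsBoxMap.le {m n : ℕ} {f : (Fin m → Bool) → (Fin n → Bool)} (hf : IsBoxMap f) : m ≤ n := by
  obtain ⟨s, hs, -⟩ := hf.exists_strictMono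
  simpa using Fintype.card_le_of_injective s hs.injective

/-- The faces of the `n`-cube. -/
abbrev Face (n : ℕ) : Type := Σ m : ℕ, (Box.mk m ⟶ Box.mk n)

instance (n : ℕ) : Finite (Face n) := by
  have : ∀ m : ℕ, Finite (Box.mk m ⟶ Box.mk n) := fun m =>
    inferInstanceAs (Finite {f : (Fin m → Bool) → (Fin n → Bool) // IsBoxMap f})
  refine Finite.of_injective
    (fun φ : Face n => (⟨⟨φ.1, Nat.lt_succ_of_le φ.2.2.le⟩, φ.2⟩ :
      Σ m : Fin (n + 1), (Box.mk m ⟶ Box.mk n))) ?_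
  rintro ⟨m, φ⟩ ⟨m', φ'⟩ h
  obtain ⟨h1, h2⟩ := Sigma.mk.inj h
  obtain rfl : m = m' := congrArg Fin.val h1
  exact congrArg (Sigma.mk m) (eq_of_heq h2)

instance (m n : ℕ) : Finite (Σ k : ℕ, (Box.mk k ⟶ Box.mk m) × (Box.mk k ⟶ Box.mk n)) := by
  refine Finite.of_injective (β := Face m × Face n) (fun z => (⟨z.1, z.2.1⟩, ⟨z.1, z.2.2⟩)) ?_
  rintro ⟨k, φ, ψ⟩ ⟨k', φ', ψ'⟩ h
  obtain ⟨h1, h2⟩ := Prod.mk.inj h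
  obtain ⟨rfl, h1⟩ := Sigma.mk.inj h1
  obtain ⟨-, h2⟩ := Sigma.mk.inj h2
  obtain rfl : φ = φ' := eq_of_heq h1
  obtain rfl : ψ = ψ' := eq_of_heq h2
  rfl

theorem bit_injective : Function.Injective bit.{u} := by
  intro a b h
  have := congrArg (fun x => (x.down : ℝ)) h
  cases a <;> cases b <;> simp [bit] at this ⊢

/-- The free coordinates of the face are those at which the point is neither `0` nor `1`. Being
listed increasingly they are determined by this set, and the constants are read off the remaining
coordinates. With `exists_inner`, this makes the cube the disjoint union of its open faces. -/
theorem inner_unique {n m m' : ℕ} {φ : Box.mk m ⟶ Box.mk n} {φ' : Box.mk m' ⟶ Box.mk n}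
    {y : Cube.{u} m} {y' : Cube.{u} m'} (hy : IsInner y) (hy' : IsInner y')
    (h : cubeMap φ.1 y = cubeMap φ'.1 y') :
    (⟨m, φ, y⟩ : Σ m : ℕ, (Box.mk m ⟶ Box.mk n) × Cube.{u} m) = ⟨m', φ', y'⟩ := by
  obtain ⟨s, hs, h1, h2⟩ := φ.2.exists_strictMono
  obtain ⟨s', hs', h1', h2'⟩ := φ'.2.exists_strictMono
  have key : ∀ {k : ℕ} {ψ : Box.mk k ⟶ Box.mk n} {z : Cube.{u} k} {r : Fin k → Fin n},
      IsInner z → (∀ v i, ψ.1 v (r i) = v i) → (∀ j ∉ Set.range r, ∃ ε, ∀ v, ψ.1 v j = ε) →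
      Set.range r = {j | ∀ ε, cubeMap ψ.1 z j ≠ bit ε} := by
    intro k ψ z r hz e1 e2
    ext j
    constructor
    · rintro ⟨i, rfl⟩ ε
      rw [cubeMap_proj fun v => e1 v i]
      exact hz i ε
    · intro hj
      by_contra hr
      obtain ⟨ε, he⟩ := e2 j hr
      exact hj ε (cubeMap_const he z)
  have hr : Set.range s = Set.range s' := by
    rw [key hy h1 h2, key hy' h1' h2', h]
  obtain rfl : m = m' := by
    have := congrArg Set.ncard hr
    rwa [← Set.image_univ, ← Set.image_univ, Set.ncard_image_of_injective _ hs.injective,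
      Set.ncard_image_of_injective _ hs'.injective, Set.ncard_univ, Set.ncard_univ, Nat.card_fin,
      Nat.card_fin] at this
  obtain rfl : s = s' := (StrictMono.range_inj hs hs').1 hr
  obtain rfl : y = y' := funext fun i => by
    rw [← cubeMap_proj (fun v => h1 v i) y, ← cubeMap_proj (fun v => h1' v i) y', h]
  obtain rfl : φ = φ' := by
    refine Box.hom_ext (funext fun v => funext fun j => ?_)
    by_cases hj : j ∈ Set.range s
    · obtain ⟨i, rfl⟩ := hj
      rw [h1, h1']
    · obtain ⟨ε, he⟩ := h2 j hj
      obtain ⟨ε', he'⟩ := h2' j (hr ▸ hj)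
      rw [he, he']
      refine bit_injective.{u} ?_
      rw [← cubeMap_const he y, ← cubeMap_const he' y, h]
  rfl

/-- The open face containing a point of the cube. -/
def face {n : ℕ} (x : Cube.{u} n) : Face n :=
  ⟨(exists_inner x).choose, (exists_inner x).choose_spec.choose⟩

/-- The coordinates of a point of the cube in the open face containing it. -/
def faceCoord {n : ℕ} (x : Cube.{u} n) : Cube.{u} (face x).1 :=
  (exists_inner x).choose_spec.choose_spec.choose

theorem isInner_faceCoord {n : ℕ} (x : Cube.{u} n) : IsInner (faceCoord x) :=
  (exists_inner x).choose_spec.choose_spec.choose_spec.1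

theorem cubeMap_faceCoord {n : ℕ} (x : Cube.{u} n) : cubeMap (face x).2.1 (faceCoord x) = x :=
  (exists_inner x).choose_spec.choose_spec.choose_spec.2

namespace PrecubicalSet

variable (K : PrecubicalSet.{u})

/-! ### The open cells of the geometric realization -/

/-- The cells of all dimensions, with a point of the corresponding cube. -/
abbrev Pointed : Type u := Σ n : ℕ, K.Cell n × Cube.{u} n

variable {K} in
/-- The open cell containing the image of a point of a cube, and its coordinates in this cell. -/
def openCell {n : ℕ} (c : K.Cell n) (x : Cube.{u} n) : K.Pointed :=
  ⟨(face x).1, K.map (face x).2.op c, faceCoord x⟩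

variable {K} in
theorem openCell_cubeMap {m n : ℕ} (c : K.Cell n) (φ : Box.mk m ⟶ Box.mk n) {y : Cube.{u} m}
    (hy : IsInner y) : openCell c (cubeMap φ.1 y) = ⟨m, K.map φ.op c, y⟩ :=
  congrArg (fun z : Σ m : ℕ, (Box.mk m ⟶ Box.mk n) × Cube.{u} m =>
    (⟨z.1, K.map z.2.1.op c, z.2.2⟩ : K.Pointed))
    (inner_unique (φ := (face (cubeMap φ.1 y)).2) (φ' := φ) (isInner_faceCoord _) hy
      (cubeMap_faceCoord _))

theorem map_map {l m n : ℕ} (c : K.Cell n) (φ : Box.mk m ⟶ Box.mk n) (ψ : Box.mk l ⟶ Box.mk m) :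
    K.map ψ.op (K.map φ.op c) = K.map (ψ ≫ φ).op c := by
  rw [op_comp, K.map_comp]
  rfl

variable {K} in
-- This compatibility with faces is what lets `openCell` descend to the colimit.
theorem openCell_face {m n : ℕ} (c : K.Cell n) (φ : Box.mk m ⟶ Box.mk n) (x : Cube.{u} m) :
    openCell (K.map φ.op c) x = openCell c (cubeMap φ.1 x) := by
  have h : cubeMap φ.1 x = cubeMap ((face x).2 ≫ φ).1 (faceCoord x) := by
    conv_lhs => rw [← cubeMap_faceCoord x]
    exact (cubeMap_comp (face x).2.2 φ.2 _).symm
  rw [h, openCell_cubeMap c _ (isInner_faceCoord x), openCell, map_map]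

/-- The cocone defining `carrier`. -/
def carrierCocone : Cocone (K.cubes ⋙ cubeTop.{u}) where
  -- With the indiscrete topology every map is continuous, so the universal property in spaces
  -- yields a map of sets.
  pt := @TopCat.of K.Pointed ⊤
  ι :=
    { app := fun j => @TopCat.ofHom _ _ _ ⊤
        (@ContinuousMap.mk _ _ _ ⊤ (fun x => openCell (K := K) j.unop.2 x) continuous_top)
      naturality := fun j k f => by
        refine TopCat.hom_ext (ContinuousMap.ext fun x => ?_)
        refine (openCell_face (K := K) k.unop.2 f.unop.1.unop x).symm.trans ?_
        exact congrArg (fun c => openCell (K := K) c x) f.unop.2 }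

/-- The open cell containing a point, and its coordinates in this cell. -/
def carrier (p : K.geom) : K.Pointed :=
  (colimit.desc (K.cubes ⋙ cubeTop.{u}) K.carrierCocone).hom p

variable {K}

theorem carrier_cellMap {n : ℕ} (c : K.Cell n) (x : Cube.{u} n) :
    K.carrier (K.cellMap c x) = openCell c x :=
  congrArg (fun f => f.hom x) (colimit.ι_desc K.carrierCocone (K.cube c))

theorem exists_cellMap (p : K.geom) :
    ∃ (n : ℕ) (c : K.Cell n) (x : Cube.{u} n), K.cellMap c x = p := by
  obtain ⟨⟨⟨⟨n⟩⟩, c⟩, x, hx⟩ := Concrete.colimit_exists_rep (K.cubes ⋙ cubeTop.{u}) p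
  exact ⟨n, c, x, hx⟩

/-- In particular `carrier` is injective: a point of `|K|_geom` is known from its open cell and its
coordinates there. -/
theorem cellMap_carrier (p : K.geom) :
    K.cellMap (K.carrier p).2.1 (K.carrier p).2.2 = p := by
  obtain ⟨n, c, x, rfl⟩ := exists_cellMap p
  rw [carrier_cellMap]
  exact (K.cellMap_face c (face x).2 (faceCoord x)).trans (congrArg _ (cubeMap_faceCoord x))

theorem carrier_of_inner {n : ℕ} (c : K.Cell n) {x : Cube.{u} n} (hx : IsInner x) :
    K.carrier (K.cellMap c x) = ⟨n, c, x⟩ := by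
  have := openCell_cubeMap c (𝟙 (Box.mk n)) hx
  rw [op_id, K.map_id] at this
  rw [carrier_cellMap]
  refine (congrArg (openCell c) (cubeMap_id n x)).symm.trans this

theorem vertexPoint_injective : Function.Injective K.vertexPoint := by
  intro v w h
  have h' := congrArg K.carrier h
  rw [vertexPoint, vertexPoint, carrier_of_inner _ fun i => i.elim0,
    carrier_of_inner _ fun i => i.elim0] at h'
  exact congrArg Prod.fst (eq_of_heq (Sigma.mk.inj h').2)

variable (K) in
/-- The cells of all dimensions. -/
abbrev AnyCell : Type u := Σ n : ℕ, K.Cell n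

/-- The open cell containing a point. -/
def cellOf (p : K.geom) : K.AnyCell := ⟨(K.carrier p).1, (K.carrier p).2.1⟩

theorem cellOf_cellMap {n : ℕ} (c : K.Cell n) (x : Cube.{u} n) :
    cellOf (K.cellMap c x) = ⟨(face x).1, K.map (face x).2.op c⟩ := by
  rw [cellOf, carrier_cellMap]
  rfl

/-! ### Closed sets, limits and compact sets in the geometric realization -/

theorem isClosed_iff {A : Set K.geom} :
    IsClosed A ↔ ∀ (n : ℕ) (c : K.Cell n), IsClosed (K.cellMap c ⁻¹' A) := by
  refine (TopCat.isClosed_iff_of_isColimit _ (colimit.isColimit (K.cubes ⋙ cubeTop.{u})) A).trans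
    ⟨fun h n c => h (K.cube c), fun h => ?_⟩
  rintro ⟨⟨⟨n⟩⟩, c⟩
  exact h n c

/-- Transports the second face along the equality of dimensions, so that the shared cell is a face
of `c` with the same source object as `f`. -/
theorem exists_common_face {m n : ℕ} {d : K.Cell m} {c : K.Cell n} {f : Face m} {g : Face n}
    {y : Cube.{u} f.1} {z : Cube.{u} g.1}
    (h : (⟨f.1, K.map f.2.op d, y⟩ : K.Pointed) = ⟨g.1, K.map g.2.op c, z⟩) :
    ∃ ψ : Box.mk f.1 ⟶ Box.mk n, K.map f.2.op d = K.map ψ.op c ∧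
      cubeMap ψ.1 y = cubeMap g.2.1 z := by
  obtain ⟨k, φ⟩ := f
  obtain ⟨l, ψ⟩ := g
  obtain ⟨h1, h2⟩ := Sigma.mk.inj h
  dsimp at h1
  subst h1
  obtain ⟨h3, h4⟩ := Prod.mk.inj (eq_of_heq h2)
  exact ⟨ψ, h3, congrArg (cubeMap ψ.1) h4⟩

/-- Two cubes are glued along finitely many common faces, so the trace on the cube `d` of the image
of `A` is a finite union, over pairs of faces carrying the same cell, of copies of the trace of `A`.
Each copy is the image of a compact set. -/
theorem isClosedMap_cellMap {n : ℕ} (c : K.Cell n) : IsClosedMap (K.cellMap c) := by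
  intro A hA
  rw [isClosed_iff]
  intro m d
  have : K.cellMap d ⁻¹' (K.cellMap c '' A) =
      ⋃ (z : Σ k : ℕ, (Box.mk k ⟶ Box.mk m) × (Box.mk k ⟶ Box.mk n))
        (_ : K.map z.2.1.op d = K.map z.2.2.op c),
        cubeMap z.2.1.1 '' (cubeMap z.2.2.1 ⁻¹' A) := by
    ext x
    simp only [Set.mem_iUnion]
    constructor
    · rintro ⟨a, ha, h⟩
      have h' : openCell d x = openCell c a := by
        rw [← carrier_cellMap, ← carrier_cellMap, h]
      obtain ⟨ψ, h1, h2⟩ := exists_common_face (f := face x) (g := face a) h'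
      refine ⟨⟨(face x).1, (face x).2, ψ⟩, h1, faceCoord x, ?_, cubeMap_faceCoord x⟩
      rw [cubeMap_faceCoord] at h2
      exact (congrArg (· ∈ A) h2).mpr ha
    · rintro ⟨⟨k, φ, ψ⟩, h1, y, hy, rfl⟩
      refine ⟨_, hy, ?_⟩
      change K.cellMap c (cubeMap ψ.1 y) = K.cellMap d (cubeMap φ.1 y)
      rw [← cellMap_face, ← cellMap_face]
      exact congrArg (fun e => K.cellMap e y) h1.symm
  rw [this]
  exact isClosed_iUnion_of_finite fun z => isClosed_iUnion_of_finite fun _ =>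
    ((hA.preimage (continuous_cubeMap z.2.2.1)).isCompact.image
      (continuous_cubeMap z.2.1.1)).isClosed

instance : T1Space K.geom := ⟨fun p => by
  obtain ⟨n, c, x, rfl⟩ := exists_cellMap p
  rw [← Set.image_singleton]
  exact isClosedMap_cellMap c _ isClosed_singleton⟩

/-- The limits in the geometric realization of what stays in finitely many closed cells are
unique. -/
theorem limit_unique {𝓕 : Ultrafilter K.geom} {S : Set K.AnyCell} (hS : S.Finite)
    (h : {p | cellOf p ∈ S} ∈ 𝓕) {p q : K.geom} (hp : (𝓕 : Filter K.geom) ≤ 𝓝 p)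
    (hq : (𝓕 : Filter K.geom) ≤ 𝓝 q) : p = q := by
  have h1 : (⋃ s ∈ S, Set.range (K.cellMap s.2)) ∈ 𝓕 := by
    filter_upwards [h] with r hr
    exact Set.mem_biUnion hr ⟨_, cellMap_carrier r⟩
  obtain ⟨⟨n, c⟩, -, hc⟩ := (Ultrafilter.finite_biUnion_mem_iff hS).1 h1
  have : (Filter.comap (K.cellMap c) 𝓕).NeBot := 𝓕.neBot.comap_of_range_mem hc
  -- The ultrafilter lives on one closed cell, so it has a cluster point `x` in the corresponding
  -- compact cube; the image of `x` is shown to be the only possible limit.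
  obtain ⟨x, hx⟩ := exists_clusterPt_of_compactSpace (Filter.comap (K.cellMap c) 𝓕)
  have key : ∀ r : K.geom, (𝓕 : Filter K.geom) ≤ 𝓝 r → K.cellMap c x = r := by
    intro r hr
    by_contra hne
    have ho : K.cellMap c ⁻¹' {r}ᶜ ∈ 𝓝 x :=
      (isOpen_compl_singleton.preimage (K.cellMap c).continuous).mem_nhds hne
    -- Regularity of the cube: `x` has a closed neighbourhood whose image, closed in `|K|_geom`,
    -- misses `r`.
    obtain ⟨V, hV, hVc, hVr⟩ := exists_mem_nhds_isClosed_subset ho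
    have hcl : IsClosed (K.cellMap c '' V) := isClosedMap_cellMap c V hVc
    have h2 : (K.cellMap c '' V)ᶜ ∈ (𝓕 : Filter K.geom) := hr (hcl.isOpen_compl.mem_nhds (by
      rintro ⟨v, hv, rfl⟩
      exact hVr hv rfl))
    have hne' : (𝓝 x ⊓ Filter.comap (K.cellMap c) 𝓕).NeBot := hx
    obtain ⟨y, hy, hy'⟩ := Filter.nonempty_of_mem
      (Filter.inter_mem_inf hV (Filter.preimage_mem_comap (m := K.cellMap c) h2))
    exact hy' ⟨y, hy, rfl⟩
  rw [← key p hp, ← key q hq]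

/-- A compact subset of the geometric realization meets finitely many open cells. -/
theorem finite_cellOf_image {C : Set K.geom} (hC : IsCompact C) : (cellOf '' C).Finite := by
  -- One point of `C` is chosen in each open cell met. All subsets of `A` are closed, since a cube
  -- contains at most one preimage in each of its finitely many open faces. So `A` is closed and
  -- discrete in a compact set, hence finite.
  obtain ⟨A, hAC, hA⟩ := Set.SurjOn.exists_bijOn_subset (Set.surjOn_image (cellOf (K := K)) C)
  have hcl : ∀ B ⊆ A, IsClosed B := by
    intro B hB
    rw [isClosed_iff]
    intro n c
    refine Set.Finite.isClosed (Set.Finite.of_finite_image (f := face) (Set.toFinite _) ?_)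
    intro x hx y hy hxy
    have h1 : cellOf (K.cellMap c x) = cellOf (K.cellMap c y) := by
      rw [cellOf_cellMap, cellOf_cellMap, hxy]
    have h2 := hA.injOn (hB hx) (hB hy) h1
    have h3 := congrArg K.carrier h2
    rw [carrier_cellMap, carrier_cellMap] at h3
    have aux : ∀ (f g : Face n) (a : Cube.{u} f.1) (b : Cube.{u} g.1), f = g →
        (⟨f.1, K.map f.2.op c, a⟩ : K.Pointed) = ⟨g.1, K.map g.2.op c, b⟩ →
        cubeMap f.2.1 a = cubeMap g.2.1 b := by
      rintro f _ a b rfl h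
      exact congrArg (cubeMap f.2.1) (Prod.mk.inj (eq_of_heq (Sigma.mk.inj h).2)).2
    have := aux _ _ _ _ hxy h3
    rwa [cubeMap_faceCoord, cubeMap_faceCoord] at this
  have hAf : A.Finite := by
    have : DiscreteTopology A := discreteTopology_iff_forall_isClosed.2 fun B => by
      have := (hcl (Subtype.val '' B) (by simp)).preimage
        (continuous_subtype_val (p := fun x => x ∈ A))
      rwa [Set.preimage_image_eq _ Subtype.val_injective] at this
    exact (hC.of_isClosed_subset (hcl A le_rfl) hAC).finite ⟨this⟩
  rw [← hA.image_eq]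
  exact hAf.image _

end PrecubicalSet

/-! ### Convex compact families of execution paths -/

namespace Flow

/-- The sets of execution paths parametrized by a compact convex set of a normed space. -/
def IsChart (X : Flow.{u}) (A : Set X.Path) : Prop :=
  ∃ (E : Type) (_ : NormedAddCommGroup E) (_ : NormedSpace ℝ E) (s : Set E) (h : s → X.Path),
    Convex ℝ s ∧ IsCompact s ∧ Continuous h ∧ Set.range h = A

theorem IsChart.isCompact {X : Flow.{u}} {A : Set X.Path} (hA : X.IsChart A) : IsCompact A := by
  obtain ⟨E, _, _, s, h, -, hs, hc, rfl⟩ := hA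
  have := isCompact_iff_compactSpace.1 hs
  exact isCompact_range hc

/-- A map from a `Δ`-generated space to the fibre product remains continuous into the kelleyfied
fibre product, where composition is continuous. -/
theorem continuous_comp_of_continuous (X : Flow.{u}) {Z : Type*} [TopologicalSpace Z]
    [DeltaGeneratedSpace Z] {f g : Z → X.Path} (hf : Continuous f) (hg : Continuous g)
    (h : ∀ z, X.tgt (f z) = X.src (g z)) : Continuous fun z => X.comp (f z) (g z) (h z) :=
  X.continuous_comp.comp ((IsGeneratedBy.equiv_symm_comp_continuous_iff
    (X := fun n : ℕ => Fin n → ℝ)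
    (fun z => (⟨(f z, g z), h z⟩ : {p : X.Path × X.Path // X.tgt p.1 = X.src p.2}))).2
    (by fun_prop))

/-- The product of the parameter sets is again compact and convex. Convexity is needed for it to be
`Δ`-generated, so that composing the two parametrizations is continuous. -/
theorem IsChart.comp {X : Flow.{u}} {A B : Set X.Path} (hA : X.IsChart A) (hB : X.IsChart B)
    (h : ∀ x ∈ A, ∀ y ∈ B, X.tgt x = X.src y) :
    X.IsChart {z | ∃ x ∈ A, ∃ y ∈ B, ∃ h, X.comp x y h = z} := by
  obtain ⟨E, _, _, s, f, hs, hs', hf, rfl⟩ := hA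
  obtain ⟨F, _, _, t, g, ht, ht', hg, rfl⟩ := hB
  have := (hs.prod ht).deltaGeneratedSpace
  refine ⟨E × F, inferInstance, inferInstance, s ×ˢ t,
    fun z => X.comp (f ⟨z.1.1, z.2.1⟩) (g ⟨z.1.2, z.2.2⟩) (h _ ⟨_, rfl⟩ _ ⟨_, rfl⟩),
    hs.prod ht, hs'.prod ht', ?_, ?_⟩
  · exact X.continuous_comp_of_continuous (hf.comp (by fun_prop)) (hg.comp (by fun_prop)) _
  · ext z
    constructor
    · rintro ⟨w, rfl⟩
      exact ⟨_, ⟨_, rfl⟩, _, ⟨_, rfl⟩, _, rfl⟩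
    · rintro ⟨_, ⟨a, rfl⟩, _, ⟨b, rfl⟩, _, rfl⟩
      exact ⟨⟨(a, b), a.2, b.2⟩, rfl⟩

end Flow

/-! ### Images of the factors of a Moore composition -/

namespace MoorePath

variable {U : Type u} [TopologicalSpace U]

theorem range_subset_comp_left (p q : MoorePath U) (h) :
    Set.range p.2 ⊆ Set.range (p.comp q h).2 := by
  rintro _ ⟨t, rfl⟩
  have h1 : (t : ℝ) ≤ (p.comp q h).1 := t.2.2.trans (Nat.cast_le.2 (Nat.le_add_right _ _))
  refine ⟨⟨t, t.2.1, h1⟩, ?_⟩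
  rw [← ext_of_mem (p.comp q h) ⟨t.2.1, h1⟩, ← ext_of_mem p t.2]
  exact comp_ext_left p q h t.2.1 t.2.2

theorem range_subset_comp_right (p q : MoorePath U) (h) :
    Set.range q.2 ⊆ Set.range (p.comp q h).2 := by
  rintro _ ⟨t, rfl⟩
  have h0 : (0 : ℝ) ≤ p.length := p.length.cast_nonneg
  have h1 : p.length + (t : ℝ) ≤ p.length + q.length := add_le_add_right t.2.2 _
  have h2 : p.length + (t : ℝ) ≤ (p.comp q h).1 := h1.trans (Nat.cast_add p.1 q.1).ge
  have h3 : 0 ≤ p.length + (t : ℝ) := add_nonneg h0 t.2.1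
  refine ⟨⟨p.length + t, h3, h2⟩, ?_⟩
  rw [← ext_of_mem (p.comp q h) ⟨h3, h2⟩, ← ext_of_mem q t.2,
    comp_ext_right p q h (le_add_of_nonneg_right t.2.1) h1, add_sub_cancel_left]

end MoorePath

namespace PrecubicalSet

variable {K : PrecubicalSet.{u}}

/-! ### States and execution paths of the natural realization -/

variable (K) in
/-- The map of flows `|□[n]|_nat → |K|_nat` given by a cube. -/
def natCell {n : ℕ} (c : K.Cell n) : natCube.{u}.obj (Box.mk n) ⟶ K.natFlow :=
  colimit.ι (K.cubes ⋙ natCube.{u}) (K.cube c)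

theorem natCell_natToTc {n : ℕ} (c : K.Cell n) : K.natCell c ≫ K.natToTc = K.cubeToTc c :=
  colimit.ι_desc K.tcCocone (K.cube c)

theorem natCell_vertex {n : ℕ} (c : K.Cell n) (α : Fin n → Bool) :
    (K.natCell c).onState ⟨α⟩ = K.natState (K.map (Box.vertex α).op c) := by
  let f : K.cube (K.map (Box.vertex α).op c) ⟶ K.cube c :=
    (CategoryOfElements.homMk (K.elementsMk _ c) (K.elementsMk _ (K.map (Box.vertex α).op c))
      (Box.vertex α).op rfl).op
  exact congrFun (congrArg Flow.Hom.onState (colimit.w (K.cubes ⋙ natCube.{u}) f))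
    ⟨fun i => i.elim0⟩

/-- The explicit model `Flow.Colim.obj` shows that every state comes from a vertex of some cube, and
this vertex is itself a 0-cube of `K`. -/
theorem natState_surjective : Function.Surjective K.natState := by
  intro s
  let F := K.cubes ⋙ natCube.{u}
  let e : K.natFlow ≅ Flow.Colim.obj F :=
    (colimit.isColimit F).coconePointUniqueUpToIso (Flow.Colim.isColimit (F := F))
  have h1 : e.inv.onState (e.hom.onState s) = s :=
    congrFun (congrArg Flow.Hom.onState e.hom_inv_id) s
  obtain ⟨⟨j, a⟩, hja⟩ := Quot.exists_rep (e.hom.onState s)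
  have h2 : e.inv.onState (Flow.Colim.ι F j a) = (colimit.ι F j).onState a :=
    congrFun (congrArg Flow.Hom.onState
      ((colimit.isColimit F).comp_coconePointUniqueUpToIso_inv (Flow.Colim.isColimit (F := F)) j)) a
  have h3 : s = (colimit.ι F j).onState a := by
    rw [← h2, ← h1]
    exact congrArg _ hja.symm
  obtain ⟨⟨⟨n⟩⟩, c⟩ := j
  exact ⟨_, ((natCell_vertex (K := K) c a.down).symm.trans h3.symm)⟩

theorem natToTc_onState_bijective : Function.Bijective K.natToTc.onState := by
  constructor
  · intro s t h
    obtain ⟨v, rfl⟩ := natState_surjective s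
    obtain ⟨w, rfl⟩ := natState_surjective t
    rw [natToTc_natState, natToTc_natState] at h
    exact congrArg K.natState h
  · exact fun v => ⟨_, K.natToTc_natState v⟩

/-- The endpoints of the Moore path recover the two states, distinct vertices of `K` being distinct
points of `|K|_geom`. -/
theorem tcPath_ext {x y : K.tcSystem.Path} (h : x.moore = y.moore) : x = y := by
  have hs : K.vertexPoint x.1.1 = K.vertexPoint y.1.1 :=
    (K.tcSystem.source_eq x.mem).symm.trans ((congrArg _ h).trans (K.tcSystem.source_eq y.mem))
  have ht : K.vertexPoint x.1.2 = K.vertexPoint y.1.2 :=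
    (K.tcSystem.target_eq x.mem).symm.trans ((congrArg _ h).trans (K.tcSystem.target_eq y.mem))
  exact MooreSystem.Path.eq (Prod.ext (vertexPoint_injective hs) (vertexPoint_injective ht)) h

theorem IsTameNatural.exists_mem {p : MoorePath K.geom} (hp : K.IsTameNatural p) :
    ∃ α β, p ∈ K.tamePaths α β := by
  induction hp with
  | cube c γ hγ => exact ⟨_, _, K.map_mem_tamePaths c _ _ γ hγ⟩
  | comp p q h hp hq ihp ihq =>
    obtain ⟨α, β, h1⟩ := ihp
    obtain ⟨α', β', h2⟩ := ihq
    exact ⟨α, β', .comp p q h hp hq, (p.comp_source q h).trans h1.2.1,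
      (p.comp_target q h).trans h2.2.2⟩

theorem IsTameNatural.length_pos {p : MoorePath K.geom} (hp : K.IsTameNatural p) :
    0 < p.length := by
  induction hp with
  | cube c γ hγ => exact hγ.length_pos
  | comp p q h hp hq ihp ihq => exact Nat.add_pos_left ihp _

/-- The Moore path of the geometric realization given by an execution path of `|K|_nat`. -/
def moore (x : K.natFlow.Path) : MoorePath K.geom :=
  MooreSystem.Path.moore (M := K.tcSystem) (K.natToTc.onPath x)

theorem isTameNatural_moore (x : K.natFlow.Path) : K.IsTameNatural (moore x) :=
  (MooreSystem.Path.mem (M := K.tcSystem) (K.natToTc.onPath x)).1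

/-- Spatiality is stated for fixed endpoints; the bijection on states shows that paths with the same
image have the same endpoints. -/
theorem onPath_injective (hK : K.Spatial) : Function.Injective K.natToTc.onPath := by
  intro x y h
  obtain ⟨α, hα⟩ := natState_surjective (K.natFlow.src x)
  obtain ⟨β, hβ⟩ := natState_surjective (K.natFlow.tgt x)
  have hs : K.natFlow.src y = K.natState α := natToTc_onState_bijective.1 (by
    rw [hα, ← Flow.Hom.src_onPath, ← Flow.Hom.src_onPath, h])
  have ht : K.natFlow.tgt y = K.natState β := natToTc_onState_bijective.1 (by
    rw [hβ, ← Flow.Hom.tgt_onPath, ← Flow.Hom.tgt_onPath, h])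
  exact congrArg Subtype.val ((hK α β).1 (a₁ := ⟨x, hα.symm, hβ.symm⟩) (a₂ := ⟨y, hs, ht⟩)
    (Subtype.ext h))

theorem onPath_surjective (hK : K.Spatial) : Function.Surjective K.natToTc.onPath := by
  intro y
  obtain ⟨x, hx⟩ := (hK (K.tcFlow.src y) (K.tcFlow.tgt y)).2 ⟨y, rfl, rfl⟩
  exact ⟨x.1, congrArg Subtype.val hx⟩

theorem moore_injective (hK : K.Spatial) : Function.Injective (moore (K := K)) :=
  fun _ _ h => onPath_injective hK (tcPath_ext h)

theorem exists_moore_eq (hK : K.Spatial) {p : MoorePath K.geom} (hp : K.IsTameNatural p) :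
    ∃ x, moore x = p := by
  obtain ⟨α, β, h⟩ := hp.exists_mem
  obtain ⟨x, hx⟩ := onPath_surjective hK (MooreSystem.Path.mk (M := K.tcSystem) α β p h)
  exact ⟨x, congrArg (MooreSystem.Path.moore (M := K.tcSystem)) hx⟩

theorem moore_source (x : K.natFlow.Path) :
    (moore x).source = K.vertexPoint (K.natToTc.onState (K.natFlow.src x)) := by
  rw [← Flow.Hom.src_onPath]
  exact K.tcSystem.source_eq (MooreSystem.Path.mem (M := K.tcSystem) (K.natToTc.onPath x))

theorem moore_target (x : K.natFlow.Path) :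
    (moore x).target = K.vertexPoint (K.natToTc.onState (K.natFlow.tgt x)) := by
  rw [← Flow.Hom.tgt_onPath]
  exact K.tcSystem.target_eq (MooreSystem.Path.mem (M := K.tcSystem) (K.natToTc.onPath x))

theorem tgt_eq_src {x y : K.natFlow.Path} (h : (moore x).target = (moore y).source) :
    K.natFlow.tgt x = K.natFlow.src y := by
  rw [moore_source, moore_target] at h
  exact natToTc_onState_bijective.1 (vertexPoint_injective h)

theorem target_eq_source {x y : K.natFlow.Path} (h : K.natFlow.tgt x = K.natFlow.src y) :
    (moore x).target = (moore y).source := by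
  rw [moore_source, moore_target, h]

theorem moore_comp (x y : K.natFlow.Path) (h : K.natFlow.tgt x = K.natFlow.src y) :
    moore (K.natFlow.comp x y h) = (moore x).comp (moore y) (target_eq_source h) :=
  congrArg (MooreSystem.Path.moore (M := K.tcSystem)) (K.natToTc.onPath_comp x y h)

/-- The execution path of `|K|_nat` given by a cube and a natural path of this cube. -/
def natPath {n : ℕ} (hn : 0 < n) (c : K.Cell n) (γ : naturalPaths n) : K.natFlow.Path :=
  (K.natCell c).onPath (MooreSystem.Path.mk (M := natCubeSystem n) ⟨fun _ => false⟩
    ⟨fun _ => true⟩ (toMoore γ) (isNaturalCubePath_toMoore hn γ))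

theorem moore_natPath {n : ℕ} (hn : 0 < n) (c : K.Cell n) (γ : naturalPaths n) :
    moore (natPath hn c γ) = (toMoore γ).map (K.cellMap c) :=
  congrArg (MooreSystem.Path.moore (M := K.tcSystem))
    (congrFun (congrArg Flow.Hom.onPath (natCell_natToTc c)) _)

theorem isChart_range_natPath {n : ℕ} (hn : 0 < n) (c : K.Cell n) :
    K.natFlow.IsChart (Set.range (natPath hn c)) := by
  have := (convex_naturalPaths n).deltaGeneratedSpace
  refine ⟨_, inferInstance, inferInstance, naturalPaths n, natPath hn c, convex_naturalPaths n,
    isCompact_naturalPaths n, ?_, rfl⟩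
  exact (K.natCell c).continuous_onPath.comp (MooreSystem.Path.continuous_of
    (M := natCubeSystem n) (IsLocallyConstant.const _) (continuous_toMoore n))

/-- The definition of tame natural paths splits the image in `|K|_geom`; surjectivity lifts the
pieces and injectivity identifies the lifted decomposition with `x`. -/
theorem exists_natPath_or_comp (hK : K.Spatial) (x : K.natFlow.Path) :
    (∃ (n : ℕ) (hn : 0 < n) (c : K.Cell n) (γ : naturalPaths n), natPath hn c γ = x) ∨
      ∃ y z h, K.natFlow.comp y z h = x := by
  have key : ∀ p : MoorePath K.geom, K.IsTameNatural p → moore x = p →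
      (∃ (n : ℕ) (hn : 0 < n) (c : K.Cell n) (γ : naturalPaths n), natPath hn c γ = x) ∨
      ∃ y z h, K.natFlow.comp y z h = x := by
    rintro _ (⟨c, γ, hγ⟩ | ⟨p, q, h, hp, hq⟩) hx
    · have hn := hγ.length_pos
      rw [hγ.length_eq] at hn
      obtain ⟨γ, rfl⟩ := hγ.exists_toMoore
      exact .inl ⟨_, hn, c, γ, moore_injective hK ((moore_natPath hn c γ).trans hx.symm)⟩
    · obtain ⟨y, rfl⟩ := exists_moore_eq hK hp
      obtain ⟨z, rfl⟩ := exists_moore_eq hK hq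
      exact .inr ⟨y, z, tgt_eq_src h, moore_injective hK ((moore_comp y z _).trans hx.symm)⟩
  exact key _ (isTameNatural_moore x) rfl

/-! ### Finite covers by charts -/

/-- The execution paths of `|K|_nat` of given length which meet only given open cells. -/
def pathsIn (S : Set K.AnyCell) (ℓ : ℕ) : Set K.natFlow.Path :=
  {x | (moore x).length = ℓ ∧ ∀ t, cellOf ((moore x).2 t) ∈ S}

variable (K) in
/-- The sets of execution paths covered by finitely many charts with fixed endpoints. -/
def FinitelyCharted (Q : Set K.natFlow.Path) : Prop :=
  ∃ 𝒜 : Set (Set K.natFlow.Path), 𝒜.Finite ∧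
    (∀ A ∈ 𝒜, K.natFlow.IsChart A ∧ ∃ a b, ∀ x ∈ A, K.natFlow.src x = a ∧ K.natFlow.tgt x = b) ∧
    Q ⊆ ⋃₀ 𝒜

theorem FinitelyCharted.mono {Q R : Set K.natFlow.Path} (hR : K.FinitelyCharted R) (h : Q ⊆ R) :
    K.FinitelyCharted Q := by
  obtain ⟨𝒜, h1, h2, h3⟩ := hR
  exact ⟨𝒜, h1, h2, h.trans h3⟩

theorem FinitelyCharted.biUnion {ι : Type*} {J : Set ι} (hJ : J.Finite)
    {Q : ι → Set K.natFlow.Path} (hQ : ∀ i ∈ J, K.FinitelyCharted (Q i)) :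
    K.FinitelyCharted (⋃ i ∈ J, Q i) := by
  choose! 𝒜 h1 h2 h3 using hQ
  refine ⟨⋃ i ∈ J, 𝒜 i, hJ.biUnion h1, fun A hA => ?_, ?_⟩
  · obtain ⟨i, hi, hA⟩ := Set.mem_iUnion₂.1 hA
    exact h2 i hi A hA
  · refine Set.iUnion₂_subset fun i hi => (h3 i hi).trans ?_
    exact Set.sUnion_subset_sUnion (Set.subset_biUnion_of_mem (u := 𝒜) hi)

theorem FinitelyCharted.union {Q R : Set K.natFlow.Path} (hQ : K.FinitelyCharted Q)
    (hR : K.FinitelyCharted R) : K.FinitelyCharted (Q ∪ R) := by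
  obtain ⟨𝒜, h1, h2, h3⟩ := hQ
  obtain ⟨ℬ, k1, k2, k3⟩ := hR
  refine ⟨𝒜 ∪ ℬ, h1.union k1, ?_, ?_⟩
  · rintro A (hA | hA)
    exacts [h2 A hA, k2 A hA]
  · rw [Set.sUnion_union]
    exact Set.union_subset_union h3 k3

/-- Charts with fixed endpoints are either composable everywhere or nowhere, so it suffices to
compose the composable pairs. -/
theorem FinitelyCharted.comp {Q R : Set K.natFlow.Path} (hQ : K.FinitelyCharted Q)
    (hR : K.FinitelyCharted R) :
    K.FinitelyCharted {z | ∃ x ∈ Q, ∃ y ∈ R, ∃ h, K.natFlow.comp x y h = z} := by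
  obtain ⟨𝒜, h1, h2, h3⟩ := hQ
  obtain ⟨ℬ, k1, k2, k3⟩ := hR
  let C : Set K.natFlow.Path × Set K.natFlow.Path → Set K.natFlow.Path := fun p =>
    {z | ∃ x ∈ p.1, ∃ y ∈ p.2, ∃ h, K.natFlow.comp x y h = z}
  refine ⟨C '' {p | (p ∈ 𝒜 ×ˢ ℬ) ∧ ∀ x ∈ p.1, ∀ y ∈ p.2, K.natFlow.tgt x = K.natFlow.src y},
    ((h1.prod k1).subset fun _ h => h.1).image _, ?_, ?_⟩
  · rintro _ ⟨⟨A, B⟩, ⟨⟨hA, hB⟩, hAB⟩, rfl⟩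
    obtain ⟨e1, a, b, e2⟩ := h2 A hA
    obtain ⟨e3, b', c, e4⟩ := k2 B hB
    refine ⟨e1.comp e3 hAB, a, c, ?_⟩
    rintro _ ⟨x, hx, y, hy, h, rfl⟩
    rw [Flow.src_comp, Flow.tgt_comp]
    exact ⟨(e2 x hx).1, (e4 y hy).2⟩
  · rintro _ ⟨x, hx, y, hy, h, rfl⟩
    obtain ⟨A, hA, hxA⟩ := h3 hx
    obtain ⟨B, hB, hyB⟩ := k3 hy
    refine ⟨_, ⟨(A, B), ⟨⟨hA, hB⟩, fun x' hx' y' hy' => ?_⟩, rfl⟩, x, hxA, y, hyB, h, rfl⟩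
    obtain ⟨-, a, b, e2⟩ := h2 A hA
    obtain ⟨-, b', c, e4⟩ := k2 B hB
    rw [(e2 x' hx').2, (e4 y' hy').1, ← (e2 x hxA).2, ← (e4 y hyB).1, h]

theorem finitelyCharted_range_natPath {n : ℕ} (hn : 0 < n) (c : K.Cell n) :
    K.FinitelyCharted (Set.range (natPath hn c)) := by
  refine ⟨{Set.range (natPath hn c)}, Set.finite_singleton _, ?_, by simp⟩
  rintro _ rfl
  refine ⟨isChart_range_natPath hn c, (K.natCell c).onState ⟨fun _ => false⟩,
    (K.natCell c).onState ⟨fun _ => true⟩, ?_⟩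
  rintro _ ⟨γ, rfl⟩
  exact ⟨Flow.Hom.src_onPath _ _, Flow.Hom.tgt_onPath _ _⟩

/-- The open faces met by a natural path of a cube of `K`, with the corresponding cells. -/
def metFaces (S : Set K.AnyCell) {n : ℕ} (z : K.Cell n × naturalPaths n) : Set (Face n × S) :=
  {w | (∃ t, face ((toMoore.{u} z.2).2 t) = w.1) ∧ (⟨w.1.1, K.map w.1.2.op z.1⟩ : K.AnyCell) = w.2}

/-- At each time `γ` lies in an open face to which `c` and `d` assign the same cell, so `γ` has the
same image in `|K|_geom` through both cubes; spatiality then identifies the two execution paths. The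
path `δ` only witnesses that `d` has the same configuration. -/
theorem natPath_eq_of_metFaces (hK : K.Spatial) {S : Set K.AnyCell} {n : ℕ} (hn : 0 < n)
    {c d : K.Cell n} {γ δ : naturalPaths n} (h : metFaces S (c, γ) = metFaces S (d, δ))
    (hS : ∀ t, cellOf ((moore (natPath hn c γ)).2 t) ∈ S) : natPath hn c γ = natPath hn d γ := by
  refine moore_injective hK ?_
  rw [moore_natPath] at hS ⊢
  rw [moore_natPath]
  refine congrArg (Sigma.mk n) (ContinuousMap.ext fun t => ?_)
  let x : Cube.{u} n := (toMoore.{u} γ).2 t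
  have hx : (⟨(face x).1, K.map (face x).2.op c⟩ : K.AnyCell) ∈ S := by
    rw [← cellOf_cellMap c x]
    exact hS t
  have h1 : (face x, (⟨_, hx⟩ : S)) ∈ metFaces S (c, γ) := ⟨⟨t, rfl⟩, rfl⟩
  rw [h] at h1
  have h2 : K.map (face x).2.op d = K.map (face x).2.op c := eq_of_heq (Sigma.mk.inj h1.2).2
  change K.cellMap c x = K.cellMap d x
  rw [← cubeMap_faceCoord x, ← cellMap_face, ← cellMap_face, h2]

/-- There are finitely many sets of pairs of a face of the `n`-cube and a cell of `S`. One cube is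
kept for each set that occurs, and its chart contains all the paths with that configuration. -/
theorem finitelyCharted_cubes (hK : K.Spatial) {S : Set K.AnyCell} (hS : S.Finite) {n : ℕ}
    (hn : 0 < n) : K.FinitelyCharted {x | (∃ c γ, natPath hn c γ = x) ∧
      ∀ t, cellOf ((moore x).2 t) ∈ S} := by
  have := hS.to_subtype
  have hf : (Set.univ : Set (Set.range (metFaces S (n := n)))).Finite := Set.toFinite _
  refine (FinitelyCharted.biUnion hf fun d _ =>
    finitelyCharted_range_natPath hn d.2.choose.1).mono ?_
  rintro _ ⟨⟨c, γ, rfl⟩, hx⟩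
  let d : Set.range (metFaces S (n := n)) := ⟨metFaces S (c, γ), _, rfl⟩
  refine Set.mem_iUnion₂.2 ⟨d, trivial, γ, ?_⟩
  exact (natPath_eq_of_metFaces hK hn (δ := d.2.choose.2) d.2.choose_spec.symm hx).symm

/-- Strong induction on the length: a cube path of length `ℓ` lies in an `ℓ`-cube, and any other
path is a composite of two strictly shorter ones meeting no further cells. The charts need not lie
inside `pathsIn`. -/
theorem finitelyCharted_pathsIn (hK : K.Spatial) {S : Set K.AnyCell} (hS : S.Finite) (ℓ : ℕ) :
    K.FinitelyCharted (pathsIn S ℓ) := by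
  induction ℓ using Nat.strong_induction_on with | _ ℓ ih
  rcases Nat.eq_zero_or_pos ℓ with rfl | hℓ
  · refine ⟨∅, Set.finite_empty, by simp, fun x hx => ?_⟩
    exact ((isTameNatural_moore x).length_pos.ne' hx.1).elim
  -- The lengths are not required to add up to `ℓ`; the superfluous pairs only enlarge the cover.
  have hfin : {p : ℕ × ℕ | p.1 < ℓ ∧ p.2 < ℓ}.Finite :=
    ((Set.finite_lt_nat ℓ).prod (Set.finite_lt_nat ℓ)).subset fun _ h => h
  refine ((finitelyCharted_cubes hK hS hℓ).union (FinitelyCharted.biUnion hfin fun p hp =>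
    (ih p.1 hp.1).comp (ih p.2 hp.2))).mono ?_
  rintro x ⟨rfl, hx⟩
  rcases exists_natPath_or_comp hK x with ⟨n, hn, c, γ, rfl⟩ | ⟨y, z, h, rfl⟩
  · have hl : (moore (natPath hn c γ)).length = n := by rw [moore_natPath]; rfl
    refine .inl ⟨?_, hx⟩
    revert hℓ
    rw [hl]
    exact fun _ => ⟨c, γ, rfl⟩
  · refine .inr ?_
    have h1 := (isTameNatural_moore y).length_pos
    have h2 := (isTameNatural_moore z).length_pos
    have hc := moore_comp y z h
    have hr : ∀ r ∈ Set.range (moore (K.natFlow.comp y z h)).2, cellOf r ∈ S := by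
      rintro _ ⟨t, rfl⟩
      exact hx t
    have hl : (moore (K.natFlow.comp y z h)).length = (moore y).length + (moore z).length := by
      rw [hc]; rfl
    rw [hc] at hr
    refine Set.mem_iUnion₂.2 ⟨((moore y).length, (moore z).length), ⟨?_, ?_⟩, y, ⟨rfl, fun t => ?_⟩,
      z, ⟨rfl, fun t => ?_⟩, h, rfl⟩
    · change (moore y).length < _
      omega
    · change (moore z).length < _
      omega
    · exact hr _ (MoorePath.range_subset_comp_left _ _ _ ⟨t, rfl⟩)
    · exact hr _ (MoorePath.range_subset_comp_right _ _ _ ⟨t, rfl⟩)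

end PrecubicalSet

namespace PrecubicalSet

variable {K : PrecubicalSet.{u}}

/-! ### The continuity of the inverse -/

theorem continuous_moore : Continuous (moore (K := K)) :=
  (MooreSystem.Path.continuous_moore (M := K.tcSystem)).comp K.natToTc.continuous_onPath

/-- A limit in `|K|_nat` is detected in the geometric realization, for execution paths which meet
finitely many open cells. -/
theorem moore_eq_of_tendsto {Z : Type*} {𝓤 : Ultrafilter Z} {g : Z → K.natFlow.Path}
    {S : Set K.AnyCell} (hS : S.Finite) {ℓ : ℕ} (hg : ∀ᶠ z in 𝓤, g z ∈ pathsIn S ℓ)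
    {a : K.natFlow.Path} (ha : Filter.Tendsto g 𝓤 (𝓝 a)) {q : MoorePath K.geom}
    (hl : q.length = ℓ) (hq : ∀ t, Filter.Tendsto (fun z => (moore (g z)).ext t) 𝓤 (𝓝 (q.ext t))) :
    moore a = q := by
  have hc := (MoorePath.continuous_iff _).1 (continuous_moore (K := K))
  have hal : (moore a).length = ℓ := by
    have h1 : ∀ᶠ x in 𝓝 a, (moore x).length = (moore a).length :=
      (hc.1.isOpen_fiber _).mem_nhds rfl
    obtain ⟨z, hz, hz'⟩ := ((ha.eventually h1).and hg).exists
    rw [← hz, hz'.1]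
  refine MoorePath.eq_of_ext (hal.trans hl.symm) fun t h0 h1 => ?_
  have ht : Filter.Tendsto (fun z => (moore (g z)).ext t) 𝓤 (𝓝 ((moore a).ext t)) :=
    ((hc.2.comp (by fun_prop : Continuous fun x : K.natFlow.Path => (x, t))).tendsto a).comp ha
  -- Both `(moore a).ext t` and `q.ext t` are limits of the same points, all in the open cells of
  -- `S`.
  refine limit_unique (𝓕 := 𝓤.map fun z => (moore (g z)).ext t) hS ?_ ht (hq t)
  refine Ultrafilter.mem_map.2 ?_
  filter_upwards [hg] with z hz
  have hm : t ∈ Set.Icc (0 : ℝ) (moore (g z)).1 := ⟨h0, h1.trans (by rw [hal, ← hz.1]; rfl)⟩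
  change cellOf ((moore (g z)).ext t) ∈ S
  rw [MoorePath.ext_of_mem _ hm]
  exact hz.2 _

/-- Tested on ultrafilters: those converging to `z` are pushed by `g` into one compact chart, hence
converge to some `a`, and evaluating at each time forces `a = g z`. -/
theorem continuous_lift (hK : K.Spatial) {n : ℕ} {g : (Fin n → ℝ) → K.natFlow.Path}
    (hg : Continuous fun z => K.natToTc.onPath (g z)) : Continuous g := by
  have hc := (MoorePath.continuous_iff _).1
    ((MooreSystem.Path.continuous_moore (M := K.tcSystem)).comp hg)
  rw [continuous_iff_continuousAt]
  intro z
  -- `ℝⁿ` is connected and the length is locally constant.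
  have hlen : ∀ y, (moore (g y)).length = (moore (g z)).length := fun y =>
    hc.1.apply_eq_of_preconnectedSpace y z
  -- All the points visited by the paths `g y` for `y` in a compact ball about `z`.
  let C : Set K.geom := (fun x : (Fin n → ℝ) × ℝ => (moore (g x.1)).ext x.2) ''
    (Metric.closedBall z 1 ×ˢ Set.Icc 0 ((moore (g z)).length : ℝ))
  have hC : IsCompact C := ((isCompact_closedBall z 1).prod isCompact_Icc).image hc.2
  have hS := finite_cellOf_image hC
  have hmem : ∀ y ∈ Metric.closedBall z 1, g y ∈ pathsIn (cellOf '' C) (moore (g z)).length :=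
    fun y hy => ⟨hlen y, fun t => ⟨_, ⟨(y, t), ⟨hy, t.2.1, t.2.2.trans (Nat.cast_le.2 (hlen y).le)⟩, rfl⟩,
      congrArg cellOf (MoorePath.ext_of_mem _ t.2)⟩⟩
  refine Filter.tendsto_iff_ultrafilter _ _ _ |>.2 fun 𝓤 h𝓤 => ?_
  have hev : ∀ᶠ y in 𝓤, g y ∈ pathsIn (cellOf '' C) (moore (g z)).length :=
    Filter.mem_of_superset (h𝓤 (Metric.closedBall_mem_nhds z one_pos)) hmem
  obtain ⟨𝒜, h1, h2, h3⟩ := finitelyCharted_pathsIn hK hS (moore (g z)).length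
  have h4 : ⋃₀ 𝒜 ∈ 𝓤.map g := Ultrafilter.mem_map.2 (hev.mono fun y hy => h3 hy)
  obtain ⟨A, hA, hA'⟩ := (Ultrafilter.finite_sUnion_mem_iff h1).1 h4
  obtain ⟨a, -, ha⟩ := isCompact_iff_ultrafilter_le_nhds'.1 (h2 A hA).1.isCompact _ hA'
  have : a = g z := moore_injective hK (moore_eq_of_tendsto hS hev ha rfl fun t =>
    ((hc.2.comp (by fun_prop : Continuous fun y : Fin n → ℝ => (y, t))).tendsto z).mono_left h𝓤)
  rw [← this]
  exact ha

/-! ### Homeomorphisms on execution paths and the isomorphism of flows -/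

variable (K) in
/-- The natural map of flows on execution paths, as a homeomorphism. -/
def pathHomeomorph (hK : K.Spatial) : K.natFlow.Path ≃ₜ K.tcFlow.Path where
  toEquiv := Equiv.ofBijective K.natToTc.onPath ⟨onPath_injective hK, onPath_surjective hK⟩
  continuous_toFun := K.natToTc.continuous_onPath
  continuous_invFun := by
    rw [IsGeneratedBy.continuous_iff (X := fun n : ℕ => Fin n → ℝ)]
    intro n f
    refine continuous_lift hK ?_
    exact f.continuous.congr fun z => (Equiv.ofBijective_apply_symm_apply K.natToTc.onPath
      ⟨onPath_injective hK, onPath_surjective hK⟩ (f z)).symm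

theorem isHomeomorph_natToTcPath (hK : K.Spatial) (α β : K.Cell 0) :
    IsHomeomorph (K.natToTcPath α β) := by
  rw [isHomeomorph_iff_isEmbedding_surjective]
  refine ⟨⟨?_, (hK α β).1⟩, (hK α β).2⟩
  have h : IsInducing (Subtype.val ∘ K.natToTcPath α β) :=
    (K.pathHomeomorph hK).isInducing.comp IsInducing.subtypeVal
  exact (IsInducing.subtypeVal.of_comp_iff).1 h

theorem mem_tamePaths (α β : K.Cell 0)
    (x : K.tcFlow.PathSpace (K.tcState α) (K.tcState β)) :
    MooreSystem.Path.moore (M := K.tcSystem) x.1 ∈ K.tamePaths α β := by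
  have key : ∀ y : K.tcSystem.Path, y.1.1 = α → y.1.2 = β → y.moore ∈ K.tamePaths α β := by
    rintro y rfl rfl
    exact y.mem
  exact key x.1 x.2.1 x.2.2

variable (K) in
/-- The tame natural paths between two vertices, as execution paths of `|K|_tc`. -/
def tamePathsEquiv (α β : K.Cell 0) :
    DeltaKelley (K.tamePaths α β) ≃ K.tcFlow.PathSpace (K.tcState α) (K.tcState β) where
  toFun p := ⟨(⟨(α, β), p⟩ : K.tcSystem.Path), rfl, rfl⟩
  invFun x := WithGeneratedByTopology.equiv.symm ⟨_, mem_tamePaths α β x⟩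
  left_inv _ := rfl
  right_inv x := Subtype.ext (tcPath_ext (K := K) (y := x.1) rfl)

/-- The execution paths of `tcFlow` are a disjoint union of kelleyfied pieces, so the subspace of
paths between two states carries the topology of its own summand. -/
theorem isInducing_tamePathsEquiv (α β : K.Cell 0) : IsInducing (K.tamePathsEquiv α β) := by
  have h : IsInducing (fun p => (K.tamePathsEquiv α β p).1) :=
    (@IsEmbedding.sigmaMk (K.Cell 0 × K.Cell 0)
      (fun ab => DeltaKelley (K.tamePaths ab.1 ab.2)) _ (α, β)).isInducing
  exact (IsInducing.subtypeVal.of_comp_iff).1 h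

variable (K) in
/-- The execution paths of `|K|_tc` between two states. -/
def tcPathSpaceHomeomorph (α β : K.Cell 0) :
    K.tcFlow.PathSpace (K.tcState α) (K.tcState β) ≃ₜ DeltaKelley (K.tamePaths α β) :=
  ((K.tamePathsEquiv α β).toHomeomorphOfIsInducing (isInducing_tamePathsEquiv α β)).symm

end PrecubicalSet

/-- A bijective map of flows which is a homeomorphism on execution paths is an isomorphism. -/
theorem Flow.isIso_of_homeomorph {X Y : Flow.{u}} (f : X ⟶ Y) (hs : Function.Bijective f.onState)
    (e : X.Path ≃ₜ Y.Path) (he : ∀ x, e x = f.onPath x) : IsIso f := by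
  have hi : Function.Injective f.onPath := fun x y h => e.injective (by rw [he, he, h])
  have hr : ∀ y, f.onPath (e.symm y) = y := fun y => by rw [← he, e.apply_symm_apply]
  let s : X.State ≃ Y.State := Equiv.ofBijective _ hs
  have hsr : ∀ b, f.onState (s.symm b) = b := s.apply_symm_apply
  have hsrc : ∀ y, X.src (e.symm y) = s.symm (Y.src y) := fun y => hs.1 (by
    rw [hsr, ← Hom.src_onPath, hr])
  have htgt : ∀ y, X.tgt (e.symm y) = s.symm (Y.tgt y) := fun y => hs.1 (by
    rw [hsr, ← Hom.tgt_onPath, hr])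
  let g : Hom Y X :=
    { onState := s.symm
      onPath := e.symm
      continuous_onPath := e.symm.continuous
      src_onPath := hsrc
      tgt_onPath := htgt
      -- Compatibility of the inverse with composition is checked after applying the injective map
      -- `f.onPath`.
      onPath_comp := fun x y h => hi (by
        rw [hr, Hom.onPath_comp]
        congr 1 <;> exact (hr _).symm) }
  refine ⟨⟨(g :), Flow.hom_ext (funext fun a => ?_) (funext fun x => ?_),
    Flow.hom_ext (funext fun a => ?_) (funext fun x => ?_)⟩⟩
  · exact s.symm_apply_apply a
  · exact hi (hr _)
  · exact hsr a
  · exact hr x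

end Precubical

end

theorem mainTheorem2 (K : Precubical.PrecubicalSet.{u}) (hK : K.Spatial) :
    IsIso K.natToTc ∧
    ∀ α β : K.Cell 0,
      IsHomeomorph (K.natToTcPath α β) ∧
      ∃ e : K.natFlow.PathSpace (K.natState α) (K.natState β) ≃ₜ
          Precubical.DeltaKelley (K.tamePaths α β),
        ∀ x, K.natToTc.onPath x.1 = (⟨(α, β), e x⟩ : K.tcSystem.Path) := by
  refine ⟨Precubical.Flow.isIso_of_homeomorph _
    Precubical.PrecubicalSet.natToTc_onState_bijective (K.pathHomeomorph hK) fun _ => rfl,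
    fun α β => ?_⟩
  have h := Precubical.PrecubicalSet.isHomeomorph_natToTcPath hK α β
  refine ⟨h, (h.homeomorph _).trans (K.tcPathSpaceHomeomorph α β), fun x => ?_⟩
  exact congrArg Subtype.val ((K.tcPathSpaceHomeomorph α β).symm_apply_apply
    (K.natToTcPath α β x)).symm
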